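/- Let $S^1=\mathbb R/\mathbb Z$, let $u_0\in C^2(S^1)$ and $\sigma=\int_0^1u_0(\theta)\,d\theta$. For $\lambda\in\{2,3\}$ put $\gamma=\frac{2}{\lambda-1}$ (so $\gamma=2$ for $\lambda=2$ and $\gamma=1$ for $\lambda=3$). Let $I\subset[0,\infty)$ be an interval containing $0$. For $x\colon I\to C^1(S^1)$, written $x(t,\theta)$, consider the equation $$x_{tt}(t,\theta)=F(t,\theta)\,x(t,\theta),\qquad x(0,\theta)=1,\quad x_t(0,\theta)=\tfrac1\gamma u_0'(\theta),\qquad \int_0^1x(t,\theta)^\gamma\,d\theta=1, \tag{1}$$ where $$F(t,\theta)=\tfrac{\lambda(\lambda-1)\sigma}{2}\,G(t,\theta)+\tfrac{(\lambda-1)(\lambda-3)}{4}\,E(t),\qquad E(t)=\gamma^2\int_0^1x(t,\phi)^{\gamma-2}x_t(t,\phi)^2\,d\phi,$$ $$G(t,\theta)=\gamma\int_0^\theta x(t,\phi)^{\gamma-1}x_t(t,\phi)\,d\phi-\gamma\int_0^1x(t,\phi)^\gamma\int_0^\phi x(t,\psi)^{\gamma-1}x_t(t,\psi)\,d\psi\,d\phi$$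 (for $\lambda=3$ the term with $E$ has coefficient $0$ and is absent, so $F=3\sigma G$), and, with the same $F$, the equation $$y_{tt}(t,\theta)=F(t,\theta)\,y(t,\theta),\qquad y(0,\theta)=0,\quad y_t(0,\theta)=\sigma-u_0''(\theta). \tag{2}$$ (a) If $\lambda=2$, then (1) has a solution $x\in C^\infty([0,\infty),C^1(S^1))$, and (2) has a solution $y\in C^\infty([0,\infty),C^0(S^1))$. (b) If $\lambda=3$, then one of the following holds. Either (1) has a solution $x\in C^\infty([0,\infty),C^1(S^1))$ with $x(t,\theta)>0$ for all $t\ge0$ and $\theta\in S^1$, and (2) has a solution $y\in C^\infty([0,\infty),C^0(S^1))$; or there are $T>0$ and $\varepsilon>0$ (depending on $u_0$) such that (1) has a solution $x\in C^\infty([0,T+\varepsilon),C^1(S^1))$ for which $T$ is the first time $t$ with $x(t,\theta)=0$ for some $\theta\in S^1$, and (2) has a solution $y\in C^\infty([0,T+\varepsilon),C^0(S^1))$. -/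

import Mathlib

open scoped ContDiff

noncomputable section

namespace MuLambda

/-- The Banach space `C¹(S¹)`, `S¹ = ℝ/ℤ`, realised as the space of pairs `(f, f')` of continuous
functions on the circle such that the second component is the derivative of the first one.
The norm inherited from the product is the `C¹` norm `max (sup |f|) (sup |f'|)`. -/
def C1Circle : Submodule ℝ (C(UnitAddCircle, ℝ) × C(UnitAddCircle, ℝ)) where
  carrier := {p | ∀ θ : ℝ, HasDerivAt (fun s : ℝ => p.1 (s : UnitAddCircle)) (p.2 θ) θ}
  add_mem' := fun hp hq θ => (hp θ).add (hq θ)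
  zero_mem' := fun θ => hasDerivAt_const θ (0 : ℝ)
  smul_mem' := fun c _ hp θ => (hp θ).const_smul c

/-- An element of `C¹(S¹)`, viewed as a `1`-periodic function on `ℝ`. -/
def toFn (f : C1Circle) (θ : ℝ) : ℝ := f.1.1 (θ : UnitAddCircle)

/-- The exponent `γ = 2 / (λ - 1)`. -/
def gam (lam : ℝ) : ℝ := 2 / (lam - 1)

/-- The mean `σ = ∫₀¹ u₀`. -/
def mean (u₀ : ℝ → ℝ) : ℝ := ∫ θ in (0 : ℝ)..1, u₀ θ

/-! In the next definitions `X` and `V` stand for `x(t,·)` and `x_t(t,·)` at a fixed time.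
For `λ = 2` and `λ = 3` the exponent `γ` is the integer `2`, respectively `1`, and a real power
with an integer exponent is the ordinary power for every base, also a negative one. -/

/-- `E = γ² ∫₀¹ x^(γ-2) x_t² dφ`. -/
def energy (lam : ℝ) (X V : ℝ → ℝ) : ℝ :=
  gam lam ^ 2 * ∫ φ in (0 : ℝ)..1, X φ ^ (gam lam - 2) * V φ ^ 2

/-- `G(θ) = γ ∫₀^θ x^(γ-1) x_t dφ - γ ∫₀¹ x^γ ∫₀^φ x^(γ-1) x_t dψ dφ`. If `∫ x^γ = 1`, this is
the function determined by `G_θ = γ x^(γ-1) x_t` and `∫ G x^γ = 0`. -/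
def velocityDeviation (lam : ℝ) (X V : ℝ → ℝ) (θ : ℝ) : ℝ :=
  gam lam * (∫ φ in (0 : ℝ)..θ, X φ ^ (gam lam - 1) * V φ) -
    gam lam * ∫ φ in (0 : ℝ)..1, X φ ^ gam lam *
      ∫ ψ in (0 : ℝ)..φ, X ψ ^ (gam lam - 1) * V ψ

/-- The central force `F = λ(λ-1)σ/2 · G + (λ-1)(λ-3)/4 · E`. For `λ = 3` the coefficient of `E`
is zero, so the term with `E` is absent. -/
def force (lam σ : ℝ) (X V : ℝ → ℝ) (θ : ℝ) : ℝ :=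
  lam * (lam - 1) * σ / 2 * velocityDeviation lam X V θ +
    (lam - 1) * (lam - 3) / 4 * energy lam X V

/-- The force along a curve `x : I → C¹(S¹)`, at time `t ∈ I` and at the point `θ`. -/
def forceAlong (lam σ : ℝ) (I : Set ℝ) (x : ℝ → C1Circle) (t θ : ℝ) : ℝ :=
  force lam σ (toFn (x t)) (toFn (derivWithin x I t)) θ

/-- `x ∈ C^∞(I, C¹(S¹))` solves `x_tt = F x` on the time interval `I` (with `0 ∈ I`), takes its
values in the set `∫ x^γ = 1`, and has the initial data `x(0) = 1`, `x_t(0) = u₀' / γ`. -/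
structure IsXSolution (lam : ℝ) (u₀ : ℝ → ℝ) (I : Set ℝ) (x : ℝ → C1Circle) : Prop where
  smooth : ContDiffOn ℝ ∞ x I
  constraint : ∀ t ∈ I, ∫ θ in (0 : ℝ)..1, toFn (x t) θ ^ gam lam = 1
  equation : ∀ t ∈ I, ∀ θ : ℝ,
    toFn (derivWithin (derivWithin x I) I t) θ = forceAlong lam (mean u₀) I x t θ * toFn (x t) θ
  init : ∀ θ : ℝ, toFn (x 0) θ = 1
  init_deriv : ∀ θ : ℝ, toFn (derivWithin x I 0) θ = deriv u₀ θ / gam lam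

/-- `y ∈ C^∞(I, C⁰(S¹))` solves `y_tt = F y` on the time interval `I`, where `F` is the force along
`x`, with the initial data `y(0) = 0`, `y_t(0) = σ - u₀''`. -/
structure IsYSolution (lam : ℝ) (u₀ : ℝ → ℝ) (I : Set ℝ) (x : ℝ → C1Circle)
    (y : ℝ → C(UnitAddCircle, ℝ)) : Prop where
  smooth : ContDiffOn ℝ ∞ y I
  equation : ∀ t ∈ I, ∀ θ : ℝ,
    derivWithin (derivWithin y I) I t (θ : UnitAddCircle) =
      forceAlong lam (mean u₀) I x t θ * y t (θ : UnitAddCircle)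
  init : ∀ θ : ℝ, y 0 (θ : UnitAddCircle) = 0
  init_deriv : ∀ θ : ℝ,
    derivWithin y I 0 (θ : UnitAddCircle) = mean u₀ - iteratedDeriv 2 u₀ θ

end MuLambda

end

/-! ### Autonomous differential equations in a Banach space. -/

section MaximalSolution

open Set Filter Topology

variable {E : Type*} [NormedAddCommGroup E] [NormedSpace ℝ E]

/-! Since integration in `θ` gains a derivative, `F` is a smooth function of `(x, x_t)` with values
in C¹(S¹). Both equations together are therefore one smooth autonomous first order system for `(x,
x_t, y, y_t)` in a Banach space. It has a maximal solution, and by Gronwall this can stop at a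
finite time only if the C¹ norm of `F` is unbounded (`exists_maximal_forcedCurve`). The constraint
persists because `∫ x^γ - 1` and `∫ x^(γ-1) x_t` solve a linear homogeneous system with zero data.

It remains to bound `F` on bounded time intervals. For `λ = 2` the energy `∫ x_t²` is conserved
(`energy₂`). With `∫ x² = 1` it bounds the primitive of `x x_t`, hence `F` uniformly. Gronwall then
bounds `x` and `x_t` uniformly, and so also `F_θ = 2σ x x_t`.

For `λ = 3` the integral `∫ G² x` is conserved (`avg_deviation₃_sq`). As long as `x ≥ 0`, it and `∫
x = 1` bound `∫ |G| x`, which controls `G_t`. So `G` stays bounded on bounded time intervals, and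
then so does `F_θ = 3σ x_t`. Either `x` stays positive and the solution is global, or positivity
fails at a time inside the half-open interval of existence; compactness then gives a first zero, and
the solution continues beyond it. -/

/-- `z` solves `z' = f z` on `[0, a)`, one-sidedly at `0`. -/
def SolvesOn (f : E → E) (z : ℝ → E) (a : ℝ) : Prop :=
  ∀ t ∈ Ico 0 a, HasDerivWithinAt z (f (z t)) (Ici 0) t

lemma SolvesOn.mono {f : E → E} {z : ℝ → E} {a b : ℝ} (h : SolvesOn f z b) (hab : a ≤ b) :
    SolvesOn f z a :=
  fun t ht => h t ⟨ht.1, ht.2.trans_le hab⟩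

lemma SolvesOn.continuousOn {f : E → E} {z : ℝ → E} {a : ℝ} (h : SolvesOn f z a) :
    ContinuousOn z (Ico 0 a) :=
  fun t ht => (h t ht).continuousWithinAt.mono Ico_subset_Ici_self

/-- The set of agreement is closed, and it is open to the right because a C¹ field is locally
Lipschitz. -/
lemma SolvesOn.eqOn {f : E → E} (hf : ContDiff ℝ 1 f) {z w : ℝ → E} {a : ℝ}
    (hz : SolvesOn f z a) (hw : SolvesOn f w a) (h0 : z 0 = w 0) : EqOn z w (Ico 0 a) := by
  intro b hb
  have hsub : Icc 0 b ⊆ Ico 0 a := Icc_subset_Ico_right hb.2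
  have hzc := hz.continuousOn.mono hsub
  have hwc := hw.continuousOn.mono hsub
  have hcl : IsClosed ({t | z t = w t} ∩ Icc 0 b) := by
    have := (hzc.prodMk hwc).preimage_isClosed_of_isClosed isClosed_Icc isClosed_diagonal
    convert this using 1
    ext t
    simp [and_comm]
  refine (hcl.Icc_subset_of_forall_mem_nhdsWithin (a := 0) h0 ?_) ⟨hb.1, le_rfl⟩
  rintro t ⟨ht : z t = w t, ht0, htb⟩
  obtain ⟨K, s, hs, hK⟩ := (hf.contDiffAt (x := z t)).exists_lipschitzOnWith
  have hta : t ∈ Ico 0 a := ⟨ht0, htb.trans hb.2⟩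
  have ev (u : ℝ → E) (hu : SolvesOn f u a) (hut : s ∈ 𝓝 (u t)) :
      ∀ᶠ r in 𝓝[≥] t, u r ∈ s :=
    ((hu t hta).continuousWithinAt.mono (Ici_subset_Ici.2 ht0)) hut
  obtain ⟨c, hc, hcs⟩ := (mem_nhdsGE_iff_exists_Ico_subset' htb).1
    ((ev z hz hs).and (ev w hw (ht ▸ hs)))
  refine mem_nhdsWithin.2 ⟨Iio (min c b), isOpen_Iio, lt_min hc htb, ?_⟩
  rintro r ⟨hr : r < min c b, htr : t < r⟩
  have hrI : Icc t r ⊆ Icc 0 b := Icc_subset_Icc ht0 (hr.le.trans (min_le_right _ _))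
  have hIco : ∀ q ∈ Ico t r, q ∈ Ico t c := fun q hq =>
    ⟨hq.1, hq.2.trans (hr.trans_le (min_le_left _ _))⟩
  refine ODE_solution_unique_of_mem_Icc_right (v := fun _ => f) (s := fun _ => s) (K := K)
    (a := t) (b := r) (fun _ _ => hK) (hzc.mono hrI) ?_ (fun q hq => (hcs (hIco q hq)).1)
    (hwc.mono hrI) ?_ (fun q hq => (hcs (hIco q hq)).2) ht ⟨htr.le, le_rfl⟩
  · exact fun q hq => (hz q (hsub (hrI ⟨hq.1, hq.2.le⟩))).mono (Ici_subset_Ici.2 (ht0.trans hq.1))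
  · exact fun q hq => (hw q (hsub (hrI ⟨hq.1, hq.2.le⟩))).mono (Ici_subset_Ici.2 (ht0.trans hq.1))

lemma SolvesOn.congr {f : E → E} {z w : ℝ → E} {a : ℝ} (hz : SolvesOn f z a)
    (h : EqOn w z (Ico 0 a)) : SolvesOn f w a := by
  intro t ht
  rw [h ht]
  refine (hz t ht).congr_of_eventuallyEq ?_ (h ht)
  filter_upwards [self_mem_nhdsWithin, mem_nhdsWithin_of_mem_nhds (Iio_mem_nhds ht.2)] with r h1 h2
  exact h ⟨h1, h2⟩

/-- At `s` the derivatives from the left and from the right are both `f (z s)`, so the pieces join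
differentiably. -/
lemma SolvesOn.glue {f : E → E} {z w : ℝ → E} {s b : ℝ} (hs : 0 ≤ s)
    (hz : SolvesOn f z s) (hzs : HasDerivWithinAt z (f (z s)) (Ici 0) s) (hzw : w s = z s)
    (hw : ∀ t ∈ Ico s b, HasDerivAt w (f (w t)) t) :
    SolvesOn f (fun t => if t ≤ s then z t else w t) b := by
  intro t ht
  rcases lt_trichotomy t s with h | h | h
  · simp only [h.le, if_true]
    refine (hz t ⟨ht.1, h⟩).congr_of_eventuallyEq ?_ (by simp [h.le])
    filter_upwards [mem_nhdsWithin_of_mem_nhds (Iio_mem_nhds h)] with r hr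
    simp [(show r < s from hr).le]
  · subst h
    simp only [le_refl, if_true]
    have h1 : HasDerivWithinAt (fun r => if r ≤ t then z r else w r) (f (z t)) (Icc 0 t) t :=
      (hzs.mono Icc_subset_Ici_self).congr (fun r hr => by simp [hr.2]) (by simp)
    have h2 : HasDerivWithinAt (fun r => if r ≤ t then z r else w r) (f (z t)) (Ici t) t := by
      rw [← hzw]
      refine (hw t ⟨le_rfl, ht.2⟩).hasDerivWithinAt.congr (fun r hr => ?_) (by simp [hzw])
      rcases eq_or_lt_of_le (show t ≤ r from hr) with h | h
      · simp [← h, hzw]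
      · simp [not_le.2 h]
    have := h1.union h2
    rwa [Icc_union_Ici_eq_Ici ht.1] at this
  · simp only [not_le.2 h, if_false]
    refine ((hw t ⟨h.le, ht.2⟩).congr_of_eventuallyEq ?_).hasDerivWithinAt
    filter_upwards [Ioi_mem_nhds h] with r hr
    simp [not_le.2 (show s < r from hr)]

/-- A bounded velocity makes `z` Lipschitz, so `z` has a limit at `T`. Near that limit the local
existence time is uniform, so restarting close enough to `T` goes past `T`. -/
lemma SolvesOn.exists_extension [CompleteSpace E] {f : E → E} (hf : ContDiff ℝ 1 f) {z : ℝ → E}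
    {T : ℝ} (hT : 0 < T) (hz : SolvesOn f z T) {C : ℝ} (hC : ∀ t ∈ Ico 0 T, ‖f (z t)‖ ≤ C) :
    ∃ b > T, ∃ w : ℝ → E, w 0 = z 0 ∧ SolvesOn f w b := by
  have hlip : ∀ s ∈ Ico 0 T, ∀ t ∈ Ico 0 T, ‖z t - z s‖ ≤ C * ‖t - s‖ := fun s hs t ht =>
    (convex_Ico 0 T).norm_image_sub_le_of_norm_hasDerivWithin_le
      (fun r hr => (hz r hr).mono Ico_subset_Ici_self) hC hs ht
  have hC0 : 0 ≤ C := (norm_nonneg _).trans (hC 0 ⟨le_rfl, hT⟩)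
  have hne : (𝓝[Ico 0 T] T).NeBot := by
    rw [← mem_closure_iff_nhdsWithin_neBot, closure_Ico hT.ne]
    exact ⟨hT.le, le_rfl⟩
  have hcau : Cauchy (map z (𝓝[Ico 0 T] T)) := by
    have hlw : LipschitzOnWith C.toNNReal z (Ico 0 T) := by
      refine LipschitzOnWith.of_dist_le_mul fun x hx y hy => ?_
      rw [dist_eq_norm, dist_eq_norm, Real.coe_toNNReal _ hC0]
      exact hlip y hy x hx
    exact (cauchy_nhds.mono nhdsWithin_le_nhds).map_of_le hlw.uniformContinuousOn
      (le_principal_iff.2 self_mem_nhdsWithin)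
  obtain ⟨x, hx⟩ := CompleteSpace.complete hcau
  obtain ⟨r, hr, ε, hε, H⟩ :=
    (hf.contDiffAt (x := x)).exists_forall_mem_closedBall_exists_eq_forall_mem_Ioo_hasDerivAt 0
  have h1 : ∀ᶠ t in 𝓝[Ico 0 T] T, z t ∈ Metric.closedBall x r :=
    hx (Metric.closedBall_mem_nhds x hr)
  have h2 : ∀ᶠ t in 𝓝[Ico 0 T] T, T - ε < t :=
    mem_nhdsWithin_of_mem_nhds (Ioi_mem_nhds (by linarith))
  obtain ⟨s, ⟨hs1, hs2⟩, hs⟩ := ((h1.and h2).and self_mem_nhdsWithin).exists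
  obtain ⟨α, hα0, hα⟩ := H (z s) hs1
  refine ⟨s + ε, by linarith, _, ?_, SolvesOn.glue (w := fun t => α (t - s)) hs.1
    (hz.mono hs.2.le) (hz s hs) (by simp [hα0]) fun t ht => ?_⟩
  · simp [hs.1]
  · have := hα (t - s) ⟨by linarith [ht.1], by linarith [ht.2]⟩
    exact this.comp_sub_const t s

/-- Maximal solutions of an autonomous `C¹` differential equation in a Banach space: either the
solution is global in forward time, or the velocity is unbounded up to the final time. -/
theorem exists_maximal_solution [CompleteSpace E] {f : E → E} (hf : ContDiff ℝ 1 f) (z₀ : E) :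
    ∃ z : ℝ → E, z 0 = z₀ ∧ ((∀ a, SolvesOn f z a) ∨
      ∃ T > 0, SolvesOn f z T ∧ ∀ C, ∃ t ∈ Ico 0 T, C < ‖f (z t)‖) := by
  classical
  set S : Set ℝ := {a | ∃ z : ℝ → E, z 0 = z₀ ∧ SolvesOn f z a} with hS
  have hdown : ∀ a ∈ S, ∀ b ≤ a, b ∈ S := fun a ⟨z, h0, hz⟩ b hb => ⟨z, h0, hz.mono hb⟩
  obtain ⟨ε, hε, hεS⟩ : ∃ ε > 0, ε ∈ S := by
    obtain ⟨α, hα0, ε, hε, hα⟩ :=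
      (hf.contDiffAt (x := z₀)).exists_forall_mem_closedBall_exists_eq_forall_mem_Ioo_hasDerivAt₀ 0
    exact ⟨ε, hε, α, hα0, fun t ht =>
      (hα t ⟨by linarith [ht.1], by linarith [ht.2]⟩).hasDerivWithinAt⟩
  choose! Z hZ0 hZ using fun a (ha : a ∈ S) => ha
  have hagree : ∀ a ∈ S, ∀ b ∈ S, ∀ t, 0 ≤ t → t < a → t < b → Z a t = Z b t := by
    intro a ha b hb t h0 hta htb
    exact ((hZ a ha).mono (min_le_left a b)).eqOn hf ((hZ b hb).mono (min_le_right a b))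
      ((hZ0 a ha).trans (hZ0 b hb).symm) ⟨h0, lt_min hta htb⟩
  -- `A t` selects a chosen solution that lives beyond `t`; by uniqueness the selections agree
  -- locally.
  have hpaste : ∀ (A : ℝ → ℝ) (a : ℝ), (∀ t ∈ Ico 0 a, t < A t ∧ A t ∈ S) →
      (∀ t ∈ Ico 0 a, ∃ b ∈ S, t < b ∧ b ≤ a) → SolvesOn f (fun t => Z (A t) t) a := by
    intro A a hA hex t ht
    obtain ⟨b, hb, htb, hba⟩ := hex t ht
    refine ((hZ b hb).congr fun r hr => ?_) t ⟨ht.1, htb⟩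
    obtain ⟨h1, h2⟩ := hA r ⟨hr.1, hr.2.trans_le hba⟩
    exact hagree _ h2 _ hb r hr.1 h1 hr.2
  by_cases hB : BddAbove S
  · have hT : 0 < sSup S := hε.trans_le (le_csSup hB hεS)
    have hlt : ∀ a < sSup S, a ∈ S := fun a ha => by
      obtain ⟨b, hb, hab⟩ := exists_lt_of_lt_csSup ⟨ε, hεS⟩ ha
      exact hdown b hb a hab.le
    have h0 : (0 + sSup S) / 2 ∈ S := hlt _ (by linarith)
    have hsol : SolvesOn f (fun t => Z ((t + sSup S) / 2) t) (sSup S) :=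
      hpaste (fun t => (t + sSup S) / 2) _
        (fun t ht => ⟨by linarith [ht.2], hlt _ (by linarith [ht.2])⟩)
        (fun t ht => ⟨(t + sSup S) / 2, hlt _ (by linarith [ht.2]), by linarith [ht.2],
          by linarith [ht.2]⟩)
    refine ⟨fun t => Z ((t + sSup S) / 2) t, hZ0 _ h0, Or.inr ⟨sSup S, hT, hsol, fun C => ?_⟩⟩
    by_contra! hC
    obtain ⟨b, hb, w, hw0, hw⟩ := hsol.exists_extension hf hT hC
    exact absurd (le_csSup hB ⟨w, hw0.trans (hZ0 _ h0), hw⟩) (not_le.2 hb)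
  · have hall : ∀ a, a ∈ S := fun a => by
      obtain ⟨b, hb, hab⟩ := not_bddAbove_iff.1 hB a
      exact hdown b hb a hab.le
    exact ⟨fun t => Z (t + 1) t, hZ0 _ (hall _), Or.inl fun a =>
      hpaste (fun t => t + 1) a (fun t _ => ⟨by linarith, hall _⟩)
        fun t ht => ⟨a, hall _, ht.2, le_rfl⟩⟩

/-- Solutions of a smooth autonomous differential equation are smooth. -/
theorem contDiffOn_of_hasDerivWithinAt_comp {f : E → E} (hf : ContDiff ℝ ∞ f) {z : ℝ → E}
    {I : Set ℝ} (hI : UniqueDiffOn ℝ I) (hz : ∀ t ∈ I, HasDerivWithinAt z (f (z t)) I t) :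
    ContDiffOn ℝ ∞ z I := by
  rw [contDiffOn_infty]
  intro n
  induction n with
  | zero => exact contDiffOn_zero.2 fun t ht => (hz t ht).continuousWithinAt
  | succ n ih =>
    rw [Nat.cast_succ, contDiffOn_succ_iff_derivWithin hI]
    refine ⟨fun t ht => (hz t ht).differentiableWithinAt, by simp, ?_⟩
    exact ((hf.of_le (by exact_mod_cast le_top)).comp_contDiffOn ih).congr
      fun t ht => (hz t ht).derivWithin (hI t ht)

end MaximalSolution

noncomputable section

namespace MuLambda

open Set Filter Topology MeasureTheory

/-! ### Continuous functions on the circle and their means. -/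

section CircleFunctions

lemma exists_mem_Ico_coe_eq (q : UnitAddCircle) : ∃ θ ∈ Ico (0 : ℝ) 1, (θ : UnitAddCircle) = q := by
  have h := AddCircle.coe_image_Ico_eq (1 : ℝ) 0
  have hq : q ∈ ((↑) '' Ico (0 : ℝ) (0 + 1) : Set UnitAddCircle) := h ▸ mem_univ q
  simpa using hq

lemma continuous_comp_coe (f : C(UnitAddCircle, ℝ)) :
    Continuous fun θ : ℝ => f (θ : UnitAddCircle) :=
  f.continuous.comp (AddCircle.continuous_mk' 1)

lemma intervalIntegrable_comp_coe (f : C(UnitAddCircle, ℝ)) (a b : ℝ) :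
    IntervalIntegrable (fun θ : ℝ => f (θ : UnitAddCircle)) volume a b :=
  (continuous_comp_coe f).intervalIntegrable a b

lemma periodic_comp_coe (f : C(UnitAddCircle, ℝ)) :
    Function.Periodic (fun θ : ℝ => f (θ : UnitAddCircle)) 1 :=
  fun θ => congrArg f (AddCircle.coe_add_period 1 θ)

/-- The continuous function on the circle given by a continuous `1`-periodic function. -/
def ofPeriodic (g : ℝ → ℝ) (hp : Function.Periodic g 1) (hc : Continuous g) :
    C(UnitAddCircle, ℝ) where
  toFun := hp.lift
  continuous_toFun := continuous_coinduced_dom.2 hc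

@[simp]
lemma ofPeriodic_coe (g : ℝ → ℝ) (hp : Function.Periodic g 1) (hc : Continuous g) (θ : ℝ) :
    ofPeriodic g hp hc (θ : UnitAddCircle) = g θ :=
  hp.lift_coe θ

lemma norm_le_of_forall_coe {f : C(UnitAddCircle, ℝ)} {C : ℝ}
    (h : ∀ θ ∈ Ico (0 : ℝ) 1, |f (θ : UnitAddCircle)| ≤ C) : ‖f‖ ≤ C := by
  rw [ContinuousMap.norm_le_of_nonempty]
  intro q
  obtain ⟨θ, hθ, rfl⟩ := exists_mem_Ico_coe_eq q
  exact h θ hθ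

/-- The mean of a continuous function on the circle. -/
def avg : C(UnitAddCircle, ℝ) →L[ℝ] ℝ :=
  LinearMap.mkContinuous
    { toFun := fun f => ∫ θ in (0 : ℝ)..1, f (θ : UnitAddCircle)
      map_add' := fun f g => by
        simpa using intervalIntegral.integral_add (intervalIntegrable_comp_coe f 0 1)
          (intervalIntegrable_comp_coe g 0 1)
      map_smul' := fun c f => by simp } 1 fun f => by
    have := intervalIntegral.norm_integral_le_of_norm_le_const (a := 0) (b := 1)
      (f := fun θ : ℝ => f (θ : UnitAddCircle)) (C := ‖f‖) fun θ _ => f.norm_coe_le_norm _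
    simpa using this

lemma avg_apply (f : C(UnitAddCircle, ℝ)) :
    avg f = ∫ θ in (0 : ℝ)..1, f (θ : UnitAddCircle) := rfl

@[simp]
lemma avg_one : avg 1 = 1 := by simp [avg_apply]

lemma avg_mono {f g : C(UnitAddCircle, ℝ)} (h : ∀ q, f q ≤ g q) : avg f ≤ avg g :=
  intervalIntegral.integral_mono_on zero_le_one (intervalIntegrable_comp_coe f 0 1)
    (intervalIntegrable_comp_coe g 0 1) fun _ _ => h _

lemma abs_avg_le {f g : C(UnitAddCircle, ℝ)} (h : ∀ q, |f q| ≤ g q) : |avg f| ≤ avg g := by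
  rw [abs_le, ← map_neg]
  exact ⟨avg_mono fun q => (abs_le.1 (h q)).1, avg_mono fun q => (abs_le.1 (h q)).2⟩

lemma abs_avg_le_norm (f : C(UnitAddCircle, ℝ)) : |avg f| ≤ ‖f‖ := by
  have h := abs_avg_le (f := f) (g := ‖f‖ • 1) fun q => by simpa using f.norm_coe_le_norm q
  simpa using h

end CircleFunctions

/-! ### The Banach space C¹(S¹) and its product. -/

section CircleC1

/-- The Banach space `C¹(S¹)`, with the topology given by its norm. -/
def CircleC1 : Type := C1Circle

instance : NormedAddCommGroup CircleC1 := inferInstanceAs (NormedAddCommGroup C1Circle)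

instance : NormedSpace ℝ CircleC1 := inferInstanceAs (NormedSpace ℝ C1Circle)

/-- An element of `C¹(S¹)` given by a periodic function and its derivative. -/
def mkC1 (f f' : C(UnitAddCircle, ℝ))
    (h : ∀ θ : ℝ, HasDerivAt (fun s : ℝ => f (s : UnitAddCircle)) (f' (θ : UnitAddCircle)) θ) :
    CircleC1 := (⟨(f, f'), h⟩ : C1Circle)

/-- The inclusion of `C¹(S¹)` into `C⁰(S¹)`. -/
def incl : CircleC1 →L[ℝ] C(UnitAddCircle, ℝ) :=
  LinearMap.mkContinuous
    { toFun := fun f : C1Circle => f.1.1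
      map_add' := fun _ _ => rfl
      map_smul' := fun _ _ => rfl } 1 fun f : C1Circle => by
    rw [one_mul]
    exact le_max_left _ _

/-- Differentiation as a map from `C¹(S¹)` to `C⁰(S¹)`. -/
def diff : CircleC1 →L[ℝ] C(UnitAddCircle, ℝ) :=
  LinearMap.mkContinuous
    { toFun := fun f : C1Circle => f.1.2
      map_add' := fun _ _ => rfl
      map_smul' := fun _ _ => rfl } 1 fun f : C1Circle => by
    rw [one_mul]
    exact le_max_right _ _

lemma hasDerivAt_incl (f : CircleC1) (θ : ℝ) :
    HasDerivAt (fun s : ℝ => incl f (s : UnitAddCircle)) (diff f (θ : UnitAddCircle)) θ :=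
  (f : C1Circle).2 θ

lemma toFn_eq (f : CircleC1) (θ : ℝ) : toFn f θ = incl f (θ : UnitAddCircle) := rfl

lemma norm_eq_max (f : CircleC1) : ‖f‖ = max ‖incl f‖ ‖diff f‖ := rfl

lemma norm_incl_le (f : CircleC1) : ‖incl f‖ ≤ ‖f‖ := le_max_left _ _

lemma norm_diff_le (f : CircleC1) : ‖diff f‖ ≤ ‖f‖ := le_max_right _ _

lemma ext_incl_diff {f g : CircleC1} (h : incl f = incl g) (h' : diff f = diff g) : f = g :=
  Subtype.ext (p := fun p => p ∈ C1Circle) (Prod.ext h h')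

/-- The function determines its derivative, so identities in C¹(S¹) need checking on values only. -/
lemma incl_injective : Function.Injective incl := by
  intro f g h
  refine ext_incl_diff h (ContinuousMap.ext fun q => ?_)
  obtain ⟨θ, -, rfl⟩ := exists_mem_Ico_coe_eq q
  have h1 := hasDerivAt_incl f θ
  rw [h] at h1
  exact h1.unique (hasDerivAt_incl g θ)

@[simp]
lemma avg_diff (f : CircleC1) : avg (diff f) = 0 := by
  rw [avg_apply, intervalIntegral.integral_eq_sub_of_hasDerivAt
    (fun θ _ => hasDerivAt_incl f θ) (intervalIntegrable_comp_coe _ 0 1)]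
  have := periodic_comp_coe (incl f) 0
  simp only [zero_add] at this
  rw [this, sub_self]

@[simp]
lemma incl_mkC1 (f f' : C(UnitAddCircle, ℝ)) (h) : incl (mkC1 f f' h) = f := rfl

@[simp]
lemma diff_mkC1 (f f' : C(UnitAddCircle, ℝ)) (h) : diff (mkC1 f f' h) = f' := rfl

/-- The constant function `1` in `C¹(S¹)`. -/
def one : CircleC1 := mkC1 1 0 fun θ => hasDerivAt_const θ 1

@[simp] lemma incl_one : incl one = 1 := rfl

@[simp] lemma diff_one : diff one = 0 := rfl

/-- The product of two elements of `C¹(S¹)`. -/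
def mulFun (f g : CircleC1) : CircleC1 :=
  mkC1 (incl f * incl g) (diff f * incl g + incl f * diff g)
    fun θ => (hasDerivAt_incl f θ).mul (hasDerivAt_incl g θ)

lemma incl_mulFun (f g : CircleC1) : incl (mulFun f g) = incl f * incl g := rfl

lemma diff_mulFun (f g : CircleC1) :
    diff (mulFun f g) = diff f * incl g + incl f * diff g := rfl

lemma norm_mulFun_le (f g : CircleC1) : ‖mulFun f g‖ ≤ 2 * ‖f‖ * ‖g‖ := by
  have hf := norm_incl_le f
  have hf' := norm_diff_le f
  have hg := norm_incl_le g
  have hg' := norm_diff_le g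
  rw [norm_eq_max, incl_mulFun, diff_mulFun]
  have h1 : ‖incl f * incl g‖ ≤ ‖f‖ * ‖g‖ := (norm_mul_le _ _).trans (by gcongr)
  have h2 : ‖diff f * incl g‖ ≤ ‖f‖ * ‖g‖ := (norm_mul_le _ _).trans (by gcongr)
  have h3 : ‖incl f * diff g‖ ≤ ‖f‖ * ‖g‖ := (norm_mul_le _ _).trans (by gcongr)
  have h4 : 0 ≤ ‖f‖ * ‖g‖ := by positivity
  exact max_le (by linarith) ((norm_add_le _ _).trans (by linarith))

/-- Multiplication in `C¹(S¹)` as a continuous bilinear map. -/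
def mulC1 : CircleC1 →L[ℝ] CircleC1 →L[ℝ] CircleC1 :=
  LinearMap.mkContinuous₂
    (LinearMap.mk₂ ℝ mulFun
      (fun f f' g => incl_injective (by simp [incl_mulFun, add_mul]))
      (fun c f g => incl_injective (by simp [incl_mulFun]))
      (fun f g g' => incl_injective (by simp [incl_mulFun, mul_add]))
      (fun c f g => incl_injective (by simp [incl_mulFun]))) 2 norm_mulFun_le

@[simp]
lemma incl_mulC1 (f g : CircleC1) : incl (mulC1 f g) = incl f * incl g :=
  incl_mulFun f g

@[simp]
lemma diff_mulC1 (f g : CircleC1) :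
    diff (mulC1 f g) = diff f * incl g + incl f * diff g :=
  diff_mulFun f g

lemma norm_mulC1_le (f g : CircleC1) : ‖mulC1 f g‖ ≤ 2 * ‖f‖ * ‖g‖ :=
  norm_mulFun_le f g

/-- `f f'` is half the derivative of the periodic function `f²`. This and the cubic analogue below
yield the conservation laws. -/
lemma avg_incl_mul_diff (f : CircleC1) : avg (incl f * diff f) = 0 := by
  have h := avg_diff (mulC1 f f)
  rw [diff_mulC1, mul_comm (diff f), map_add] at h
  linarith

lemma avg_incl_mul_incl_mul_diff (f : CircleC1) : avg (incl f * incl f * diff f) = 0 := by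
  have h := avg_diff (mulC1 f (mulC1 f f))
  have e : diff (mulC1 f (mulC1 f f)) = (3 : ℝ) • (incl f * incl f * diff f) := by
    ext q
    simp
    ring
  rw [e, map_smul, smul_eq_mul] at h
  linarith

instance : CompleteSpace CircleC1 := by
  -- By the fundamental theorem of calculus the derivative relation is a family of integral
  -- identities, each a closed condition for uniform convergence.
  have h : (C1Circle : Set (C(UnitAddCircle, ℝ) × C(UnitAddCircle, ℝ))) =
      ⋂ θ : ℝ, {p | p.1 (θ : UnitAddCircle) - p.1 ((0 : ℝ) : UnitAddCircle) =
        ∫ s in (0 : ℝ)..θ, p.2 (s : UnitAddCircle)} := by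
    ext p
    simp only [SetLike.mem_coe, mem_iInter, mem_ofPred_eq]
    constructor
    · intro hp θ
      rw [intervalIntegral.integral_eq_sub_of_hasDerivAt (fun s _ => hp s)
        (intervalIntegrable_comp_coe _ _ _)]
    · intro hp θ
      have h1 : (fun s : ℝ => p.1 (s : UnitAddCircle)) = fun s : ℝ =>
          (∫ r in (0 : ℝ)..s, p.2 (r : UnitAddCircle)) + p.1 ((0 : ℝ) : UnitAddCircle) := by
        funext s
        rw [← hp s]
        ring
      rw [h1]
      exact ((continuous_comp_coe p.2).integral_hasStrictDerivAt 0 θ).hasDerivAt.add_const _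
  have hcl : IsClosed (C1Circle : Set (C(UnitAddCircle, ℝ) × C(UnitAddCircle, ℝ))) := by
    rw [h]
    refine isClosed_iInter fun θ => isClosed_eq ?_ ?_
    · exact ((continuous_eval_const _).comp continuous_fst).sub
        ((continuous_eval_const _).comp continuous_fst)
    · have hev : Continuous fun pr : (C(UnitAddCircle, ℝ) × C(UnitAddCircle, ℝ)) × ℝ =>
          pr.1.2 (pr.2 : UnitAddCircle) := by
        have : Continuous fun pr : (C(UnitAddCircle, ℝ) × C(UnitAddCircle, ℝ)) × ℝ =>
            (pr.1.2, (pr.2 : UnitAddCircle)) :=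
          (continuous_snd.comp continuous_fst).prodMk
            ((AddCircle.continuous_mk' 1).comp continuous_snd)
        exact ContinuousEval.continuous_eval.comp this
      exact intervalIntegral.continuous_parametric_intervalIntegral_of_continuous' hev 0 θ
  have : CompleteSpace C1Circle := hcl.completeSpace_coe
  exact inferInstanceAs (CompleteSpace C1Circle)

end CircleC1

/-! ### Periodic primitives. -/

section Primitive

lemma intervalIntegral_add_one (f : C(UnitAddCircle, ℝ)) (θ : ℝ) :
    ∫ s in (0 : ℝ)..(θ + 1), f (s : UnitAddCircle) =
      (∫ s in (0 : ℝ)..θ, f (s : UnitAddCircle)) + avg f := by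
  rw [← intervalIntegral.integral_add_adjacent_intervals (intervalIntegrable_comp_coe f 0 θ)
    (intervalIntegrable_comp_coe f θ (θ + 1)),
    (periodic_comp_coe f).intervalIntegral_add_eq θ 0, zero_add, avg_apply]

lemma hasDerivAt_primitive (f : C(UnitAddCircle, ℝ)) (θ : ℝ) :
    HasDerivAt (fun r : ℝ => (∫ s in (0 : ℝ)..r, f (s : UnitAddCircle)) - r * avg f)
      (f (θ : UnitAddCircle) - avg f) θ := by
  have h := ((continuous_comp_coe f).integral_hasStrictDerivAt 0 θ).hasDerivAt
  have h' := h.sub ((hasDerivAt_id θ).mul_const (avg f))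
  rw [one_mul] at h'
  exact h'

lemma periodic_primitive (f : C(UnitAddCircle, ℝ)) : Function.Periodic
    (fun r : ℝ => (∫ s in (0 : ℝ)..r, f (s : UnitAddCircle)) - r * avg f) 1 := by
  intro θ
  simp only [intervalIntegral_add_one]
  ring

/-- The primitive vanishing at `0` of `f` minus its mean, as a function on the circle. -/
def primitiveFun (f : C(UnitAddCircle, ℝ)) : CircleC1 :=
  mkC1 (ofPeriodic _ (periodic_primitive f)
      (continuous_iff_continuousAt.2 fun θ => (hasDerivAt_primitive f θ).continuousAt))
    (f - avg f • 1) fun θ => by simpa using hasDerivAt_primitive f θ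

lemma incl_primitiveFun (f : C(UnitAddCircle, ℝ)) (θ : ℝ) :
    incl (primitiveFun f) (θ : UnitAddCircle) =
      (∫ s in (0 : ℝ)..θ, f (s : UnitAddCircle)) - θ * avg f := by
  simp [primitiveFun]

/-- One `avg g` bounds the integral, the other the subtracted mean. A bound by the mean of `g`, not
its supremum, is what the conserved integrals can control. -/
lemma norm_incl_primitiveFun_le {f g : C(UnitAddCircle, ℝ)} (h : ∀ q, |f q| ≤ g q) :
    ‖incl (primitiveFun f)‖ ≤ 2 * avg g := by
  refine norm_le_of_forall_coe fun θ hθ => ?_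
  rw [incl_primitiveFun]
  have h0 : 0 ≤ avg g := (abs_nonneg _).trans (abs_avg_le h)
  have h1 : |∫ s in (0 : ℝ)..θ, f (s : UnitAddCircle)| ≤ avg g :=
    calc |∫ s in (0 : ℝ)..θ, f (s : UnitAddCircle)|
        ≤ ∫ s in (0 : ℝ)..θ, g (s : UnitAddCircle) :=
          intervalIntegral.norm_integral_le_of_norm_le (f := fun s : ℝ => f (s : UnitAddCircle))
            (g := fun s : ℝ => g (s : UnitAddCircle)) hθ.1
            (Eventually.of_forall fun s _ => h _) (intervalIntegrable_comp_coe g 0 θ)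
      _ ≤ avg g := intervalIntegral.integral_mono_interval le_rfl hθ.1 hθ.2.le
            (Eventually.of_forall fun s => (abs_nonneg _).trans (h _))
            (intervalIntegrable_comp_coe g 0 1)
  have h2 : |θ * avg f| ≤ avg g := by
    rw [abs_mul, abs_of_nonneg hθ.1]
    calc θ * |avg f| ≤ 1 * |avg f| := by gcongr; exact hθ.2.le
      _ ≤ avg g := by rw [one_mul]; exact abs_avg_le h
  exact (abs_sub _ _).trans (by linarith)

/-- The linear map sending `f` to the primitive vanishing at `0` of `f` minus its mean. -/
def primitive : C(UnitAddCircle, ℝ) →L[ℝ] CircleC1 :=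
  LinearMap.mkContinuous
    { toFun := primitiveFun
      map_add' := fun f g => incl_injective <| ContinuousMap.ext fun q => by
        obtain ⟨θ, -, rfl⟩ := exists_mem_Ico_coe_eq q
        simp only [map_add, ContinuousMap.add_apply, incl_primitiveFun]
        rw [intervalIntegral.integral_add (intervalIntegrable_comp_coe f 0 θ)
          (intervalIntegrable_comp_coe g 0 θ)]
        ring
      map_smul' := fun c f => incl_injective <| ContinuousMap.ext fun q => by
        obtain ⟨θ, -, rfl⟩ := exists_mem_Ico_coe_eq q
        simp only [map_smul, ContinuousMap.smul_apply, incl_primitiveFun, smul_eq_mul,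
          intervalIntegral.integral_const_mul, RingHom.id_apply]
        ring } 2 fun f => by
    have h1 := norm_incl_primitiveFun_le (f := f) (g := ‖f‖ • 1)
      fun q => by simpa using f.norm_coe_le_norm q
    have h2 : ‖diff (primitiveFun f)‖ ≤ 2 * ‖f‖ := by
      have h3 : ‖avg f • (1 : C(UnitAddCircle, ℝ))‖ ≤ ‖f‖ := by
        rw [norm_smul, norm_one, mul_one]
        exact abs_avg_le_norm f
      exact (norm_sub_le _ _).trans (by linarith)
    have h3 : ‖incl (primitiveFun f)‖ ≤ 2 * ‖f‖ := by simpa using h1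
    exact max_le h3 h2

lemma incl_primitive (f : C(UnitAddCircle, ℝ)) (θ : ℝ) :
    incl (primitive f) (θ : UnitAddCircle) =
      (∫ s in (0 : ℝ)..θ, f (s : UnitAddCircle)) - θ * avg f :=
  incl_primitiveFun f θ

lemma diff_primitive (f : C(UnitAddCircle, ℝ)) : diff (primitive f) = f - avg f • 1 := rfl

lemma norm_incl_primitive_le {f g : C(UnitAddCircle, ℝ)} (h : ∀ q, |f q| ≤ g q) :
    ‖incl (primitive f)‖ ≤ 2 * avg g :=
  norm_incl_primitiveFun_le h

end Primitive

end MuLambda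

end

noncomputable section

namespace MuLambda

open Set Filter Topology

section Calculus

variable {E F G : Type*} [NormedAddCommGroup E] [NormedSpace ℝ E] [NormedAddCommGroup F]
  [NormedSpace ℝ F] [NormedAddCommGroup G] [NormedSpace ℝ G]

lemma hasDerivWithinAt_fst {z : ℝ → E × F} {z' : E × F} {s : Set ℝ} {t : ℝ}
    (h : HasDerivWithinAt z z' s t) : HasDerivWithinAt (fun r => (z r).1) z'.1 s t :=
  (ContinuousLinearMap.fst ℝ E F).hasFDerivAt.comp_hasDerivWithinAt t h

lemma hasDerivWithinAt_snd {z : ℝ → E × F} {z' : E × F} {s : Set ℝ} {t : ℝ}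
    (h : HasDerivWithinAt z z' s t) : HasDerivWithinAt (fun r => (z r).2) z'.2 s t :=
  (ContinuousLinearMap.snd ℝ E F).hasFDerivAt.comp_hasDerivWithinAt t h

lemma hasDerivWithinAt_clm (L : E →L[ℝ] F) {z : ℝ → E} {z' : E} {s : Set ℝ} {t : ℝ}
    (h : HasDerivWithinAt z z' s t) : HasDerivWithinAt (fun r => L (z r)) (L z') s t :=
  L.hasFDerivAt.comp_hasDerivWithinAt t h

lemma contDiff_bilin (L : E →L[ℝ] F →L[ℝ] G) : ContDiff ℝ ∞ fun z : E × F => L z.1 z.2 :=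
  L.isBoundedBilinearMap.contDiff

lemma hasDerivWithinAt_incl {z : ℝ → CircleC1} {z' : CircleC1} {s : Set ℝ} {t : ℝ}
    (h : HasDerivWithinAt z z' s t) : HasDerivWithinAt (fun r => incl (z r)) (incl z') s t :=
  hasDerivWithinAt_clm incl h

lemma contDiff_incl : ContDiff ℝ ∞ incl := incl.contDiff

lemma contDiff_mulC1 : ContDiff ℝ ∞ fun z : CircleC1 × CircleC1 => mulC1 z.1 z.2 :=
  contDiff_bilin mulC1

end Calculus

/-! ### The system for `x` and `y`, and the continuation criterion. -/

section ForcedCurves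

/-- The curve `X` in `C¹(S¹)` has velocity `V` and acceleration `Φ (X, V) X` on the interval `I`,
one-sidedly at `0`. -/
structure IsForcedCurve (Φ : CircleC1 × CircleC1 → CircleC1) (I : Set ℝ) (X V : ℝ → CircleC1) :
    Prop where
  velocity : ∀ t ∈ I, HasDerivWithinAt X (V t) (Ici 0) t
  acceleration : ∀ t ∈ I, HasDerivWithinAt V (mulC1 (Φ (X t, V t)) (X t)) (Ici 0) t

/-- The curve `Y` in `C⁰(S¹)` has velocity `Z` and acceleration `F Y` on the interval `I`,
one-sidedly at `0`. -/
structure IsLinearForcedCurve (F : ℝ → CircleC1) (I : Set ℝ) (Y Z : ℝ → C(UnitAddCircle, ℝ)) :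
    Prop where
  velocity : ∀ t ∈ I, HasDerivWithinAt Y (Z t) (Ici 0) t
  acceleration : ∀ t ∈ I, HasDerivWithinAt Z (incl (F t) * Y t) (Ici 0) t

variable {Φ : CircleC1 × CircleC1 → CircleC1} {I J : Set ℝ} {X V : ℝ → CircleC1}
  {Y Z : ℝ → C(UnitAddCircle, ℝ)}

lemma IsForcedCurve.mono (h : IsForcedCurve Φ I X V) (hJ : J ⊆ I) : IsForcedCurve Φ J X V :=
  ⟨fun t ht => h.velocity t (hJ ht), fun t ht => h.acceleration t (hJ ht)⟩

lemma IsLinearForcedCurve.mono {F : ℝ → CircleC1} (h : IsLinearForcedCurve F I Y Z)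
    (hJ : J ⊆ I) : IsLinearForcedCurve F J Y Z :=
  ⟨fun t ht => h.velocity t (hJ ht), fun t ht => h.acceleration t (hJ ht)⟩

lemma exists_bound_of_norm_deriv_le {E : Type*} [NormedAddCommGroup E] [NormedSpace ℝ E]
    {W W' : ℝ → E} {T C : ℝ} (hW : ∀ t ∈ Ico 0 T, HasDerivWithinAt W (W' t) (Ici 0) t)
    (hC : ∀ t ∈ Ico 0 T, ‖W' t‖ ≤ C * ‖W t‖) : ∃ B, ∀ t ∈ Ico 0 T, ‖W t‖ ≤ B := by
  -- The absolute value makes the Gronwall bound monotone in time.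
  refine ⟨‖W 0‖ * Real.exp (|C| * T), fun t ht => ?_⟩
  have hsub : Icc 0 t ⊆ Ico 0 T := Icc_subset_Ico_right ht.2
  have h := norm_le_gronwallBound_of_norm_deriv_right_le (f := W) (f' := W') (δ := ‖W 0‖)
    (K := |C|) (ε := 0) (a := 0) (b := t)
    (fun s hs => (hW s (hsub hs)).continuousWithinAt.mono Icc_subset_Ici_self)
    (fun s hs => (hW s (hsub ⟨hs.1, hs.2.le⟩)).mono (Ici_subset_Ici.2 hs.1)) le_rfl
    (fun s hs => by
      rw [add_zero]
      exact (hC s (hsub ⟨hs.1, hs.2.le⟩)).trans (by gcongr; exact le_abs_self C))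
    t ⟨ht.1, le_rfl⟩
  rw [gronwallBound_ε0, sub_zero] at h
  refine h.trans ?_
  gcongr
  exact ht.2.le

lemma eq_zero_of_norm_deriv_le {E : Type*} [NormedAddCommGroup E] [NormedSpace ℝ E]
    {W W' : ℝ → E} {c : ℝ → ℝ} {T : ℝ}
    (hW : ∀ t ∈ Ico 0 T, HasDerivWithinAt W (W' t) (Ici 0) t) (hc : ContinuousOn c (Ico 0 T))
    (hle : ∀ t ∈ Ico 0 T, ‖W' t‖ ≤ c t * ‖W t‖) (h0 : W 0 = 0) : ∀ t ∈ Ico 0 T, W t = 0 := by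
  intro t ht
  have hsub : Icc 0 t ⊆ Ico 0 T := Icc_subset_Ico_right ht.2
  obtain ⟨C, hC⟩ := isCompact_Icc.bddAbove_image (hc.mono hsub)
  refine eq_zero_of_abs_deriv_le_mul_abs_self_of_eq_zero_right (f := W) (f' := W') (K := C)
    (a := 0) (b := t) (fun s hs => (hW s (hsub hs)).continuousWithinAt.mono Icc_subset_Ici_self)
    (fun s hs => (hW s (hsub ⟨hs.1, hs.2.le⟩)).mono (Ici_subset_Ici.2 hs.1)) h0
    (fun s hs => ?_) t ⟨ht.1, le_rfl⟩
  refine (hle s (hsub ⟨hs.1, hs.2.le⟩)).trans ?_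
  gcongr
  exact hC (mem_image_of_mem c ⟨hs.1, hs.2.le⟩)

lemma eq_of_deriv_eq_zero {W : ℝ → ℝ} {T : ℝ}
    (hW : ∀ t ∈ Ico 0 T, HasDerivWithinAt W 0 (Ici 0) t) : ∀ t ∈ Ico 0 T, W t = W 0 := by
  intro t ht
  have h := eq_zero_of_norm_deriv_le (W := fun t => W t - W 0) (W' := fun _ => 0) (c := fun _ => 0)
    (T := T) (fun t ht => (hW t ht).sub_const _) continuousOn_const (by simp) (sub_self _) t ht
  linarith

/-- The first order system for a forced curve together with a linear forced curve. -/
def forcedField (Φ : CircleC1 × CircleC1 → CircleC1)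
    (z : (CircleC1 × CircleC1) × (C(UnitAddCircle, ℝ) × C(UnitAddCircle, ℝ))) :
    (CircleC1 × CircleC1) × (C(UnitAddCircle, ℝ) × C(UnitAddCircle, ℝ)) :=
  ((z.1.2, mulC1 (Φ z.1) z.1.1), (z.2.2, incl (Φ z.1) * z.2.1))

lemma contDiff_forcedField (hΦ : ContDiff ℝ ∞ Φ) : ContDiff ℝ ∞ (forcedField Φ) := by
  unfold forcedField
  have h1 : ContDiff ℝ ∞ fun z : (CircleC1 × CircleC1) ×
      (C(UnitAddCircle, ℝ) × C(UnitAddCircle, ℝ)) => Φ z.1 := hΦ.comp contDiff_fst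
  have h2 : ContDiff ℝ ∞ fun z : (CircleC1 × CircleC1) ×
      (C(UnitAddCircle, ℝ) × C(UnitAddCircle, ℝ)) => mulC1 (Φ z.1) z.1.1 :=
    contDiff_mulC1.comp (h1.prodMk (contDiff_fst.comp contDiff_fst))
  exact ((contDiff_snd.comp contDiff_fst).prodMk h2).prodMk
    ((contDiff_snd.comp contDiff_snd).prodMk
      ((contDiff_incl.comp h1).mul (contDiff_fst.comp contDiff_snd)))

/-- The growth is linear in the state for a bounded force, so Gronwall applies. The factor 2 comes
from the product rule. -/
lemma norm_forcedField_le (z : (CircleC1 × CircleC1) × (C(UnitAddCircle, ℝ) × C(UnitAddCircle, ℝ))) :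
    ‖forcedField Φ z‖ ≤ (1 + 2 * ‖Φ z.1‖) * ‖z‖ := by
  have h11 : ‖z.1.1‖ ≤ ‖z‖ := (norm_fst_le z.1).trans (norm_fst_le z)
  have h12 : ‖z.1.2‖ ≤ ‖z‖ := (norm_snd_le z.1).trans (norm_fst_le z)
  have h21 : ‖z.2.1‖ ≤ ‖z‖ := (norm_fst_le z.2).trans (norm_snd_le z)
  have h22 : ‖z.2.2‖ ≤ ‖z‖ := (norm_snd_le z.2).trans (norm_snd_le z)
  have hΦ := norm_nonneg (Φ z.1)
  have hz := norm_nonneg z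
  have hΦz : 0 ≤ ‖Φ z.1‖ * ‖z‖ := by positivity
  have h3 : ‖mulC1 (Φ z.1) z.1.1‖ ≤ 2 * ‖Φ z.1‖ * ‖z‖ :=
    (norm_mulC1_le _ _).trans (by gcongr)
  have h4 : ‖incl (Φ z.1) * z.2.1‖ ≤ ‖Φ z.1‖ * ‖z‖ :=
    (norm_mul_le _ _).trans (by gcongr; exact norm_incl_le _)
  exact max_le (max_le (h12.trans (by linarith)) (h3.trans (by linarith)))
    (max_le (h22.trans (by linarith)) (h4.trans (by linarith)))

/-- Forced curves exist, together with linear forced curves for the same force, as long as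
the force stays bounded. -/
theorem exists_maximal_forcedCurve (hΦ : ContDiff ℝ ∞ Φ) (x₀ v₀ : CircleC1)
    (y₀ z₀ : C(UnitAddCircle, ℝ)) :
    ∃ (X V : ℝ → CircleC1) (Y Z : ℝ → C(UnitAddCircle, ℝ)),
      X 0 = x₀ ∧ V 0 = v₀ ∧ Y 0 = y₀ ∧ Z 0 = z₀ ∧ ∃ I : Set ℝ,
        (I = Ici 0 ∨ ∃ T > 0, I = Ico 0 T ∧ ∀ C, ∃ t ∈ Ico 0 T, C < ‖Φ (X t, V t)‖) ∧
        IsForcedCurve Φ I X V ∧ IsLinearForcedCurve (fun t => Φ (X t, V t)) I Y Z := by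
  obtain ⟨z, hz0, hz⟩ := exists_maximal_solution
    ((contDiff_forcedField hΦ).of_le (by exact_mod_cast le_top)) ((x₀, v₀), (y₀, z₀))
  have key : ∀ I : Set ℝ,
      (∀ t ∈ I, HasDerivWithinAt z (forcedField Φ (z t)) (Ici 0) t) →
      IsForcedCurve Φ I (fun t => (z t).1.1) (fun t => (z t).1.2) ∧
      IsLinearForcedCurve (fun t => Φ ((z t).1.1, (z t).1.2)) I
        (fun t => (z t).2.1) (fun t => (z t).2.2) := fun I hI =>
    ⟨⟨fun t ht => hasDerivWithinAt_fst (hasDerivWithinAt_fst (hI t ht)),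
        fun t ht => hasDerivWithinAt_snd (hasDerivWithinAt_fst (hI t ht))⟩,
      ⟨fun t ht => hasDerivWithinAt_fst (hasDerivWithinAt_snd (hI t ht)),
        fun t ht => hasDerivWithinAt_snd (hasDerivWithinAt_snd (hI t ht))⟩⟩
  refine ⟨fun t => (z t).1.1, fun t => (z t).1.2, fun t => (z t).2.1, fun t => (z t).2.2,
    by simp [hz0], by simp [hz0], by simp [hz0], by simp [hz0], ?_⟩
  rcases hz with hz | ⟨T, hT, hz, hub⟩
  · exact ⟨Ici 0, Or.inl rfl,
      key _ fun t ht => hz (t + 1) t ⟨ht, by linarith⟩⟩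
  · refine ⟨Ico 0 T, Or.inr ⟨T, hT, rfl, fun C => ?_⟩, key _ hz⟩
    -- A bounded force would bound the state by Gronwall, hence the field, against maximality.
    by_contra! hC
    have hbd : ∀ t ∈ Ico 0 T, ‖forcedField Φ (z t)‖ ≤ (1 + 2 * C) * ‖z t‖ := fun t ht =>
      (norm_forcedField_le _).trans (by gcongr; exact hC t ht)
    obtain ⟨B, hB⟩ := exists_bound_of_norm_deriv_le hz hbd
    obtain ⟨t, ht, hlt⟩ := hub ((1 + 2 * C) * B)
    have hC0 : 0 ≤ C := (norm_nonneg _).trans (hC t ht)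
    exact absurd ((hbd t ht).trans (by gcongr; exact hB t ht)) (not_le.2 hlt)

/-- Smoothness is read off from the joint system, which is autonomous; this is why `X` is treated
together with `Y`. -/
lemma IsForcedCurve.contDiffOn (hΦ : ContDiff ℝ ∞ Φ) (h : IsForcedCurve Φ I X V)
    (hI : UniqueDiffOn ℝ I) (hI0 : I ⊆ Ici 0)
    (hY : IsLinearForcedCurve (fun t => Φ (X t, V t)) I Y Z) :
    ContDiffOn ℝ ∞ X I ∧ ContDiffOn ℝ ∞ Y I := by
  have hz := contDiffOn_of_hasDerivWithinAt_comp (contDiff_forcedField hΦ)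
    (z := fun t => ((X t, V t), (Y t, Z t))) hI fun t ht =>
      (((h.velocity t ht).prodMk (h.acceleration t ht)).prodMk
        ((hY.velocity t ht).prodMk (hY.acceleration t ht))).mono hI0
  exact ⟨contDiff_fst.comp_contDiffOn (contDiff_fst.comp_contDiffOn hz),
    contDiff_fst.comp_contDiffOn (contDiff_snd.comp_contDiffOn hz)⟩

/-- A bound for the force in `C⁰` gives a bound for the curve and its velocity in `C⁰`. -/
lemma IsForcedCurve.exists_bound {T : ℝ} (h : IsForcedCurve Φ (Ico 0 T) X V) {C : ℝ}
    (hC : ∀ t ∈ Ico 0 T, ‖incl (Φ (X t, V t))‖ ≤ C) :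
    ∃ B, ∀ t ∈ Ico 0 T, ‖incl (X t)‖ ≤ B ∧ ‖incl (V t)‖ ≤ B := by
  obtain ⟨B, hB⟩ := exists_bound_of_norm_deriv_le (T := T) (C := 1 + C)
    (W := fun t => (incl (X t), incl (V t)))
    (W' := fun t => (incl (V t), incl (Φ (X t, V t)) * incl (X t)))
    (fun t ht => (hasDerivWithinAt_incl (h.velocity t ht)).prodMk
      (hasDerivWithinAt_incl (h.acceleration t ht))) fun t ht => by
    have h1 : ‖incl (X t)‖ ≤ ‖(incl (X t), incl (V t))‖ := norm_fst_le (incl (X t), incl (V t))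
    have h2 : ‖incl (V t)‖ ≤ ‖(incl (X t), incl (V t))‖ := norm_snd_le (incl (X t), incl (V t))
    have hC0 : 0 ≤ C := (norm_nonneg _).trans (hC t ht)
    have h3 : ‖incl (Φ (X t, V t)) * incl (X t)‖ ≤ C * ‖(incl (X t), incl (V t))‖ :=
      (norm_mul_le _ _).trans (by gcongr; exact hC t ht)
    have h4 := norm_nonneg (incl (X t), incl (V t))
    have h5 : 0 ≤ C * ‖(incl (X t), incl (V t))‖ := by positivity
    exact max_le (by linarith) (by linarith)
  exact ⟨B, fun t ht => ⟨(norm_fst_le (incl (X t), incl (V t))).trans (hB t ht),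
    (norm_snd_le (incl (X t), incl (V t))).trans (hB t ht)⟩⟩

end ForcedCurves

end MuLambda

end

noncomputable section

namespace MuLambda

open Set Filter Topology

variable {σ T : ℝ} {X V : ℝ → CircleC1}

lemma abs_avg_mul_le {f g : C(UnitAddCircle, ℝ)} (hg : ∀ q, 0 ≤ g q) :
    |avg (g * f)| ≤ ‖f‖ * avg g := by
  have h := abs_avg_le (f := g * f) (g := ‖f‖ • g) fun q => by
    have h1 : |f q| ≤ ‖f‖ := f.norm_coe_le_norm q
    rw [ContinuousMap.mul_apply, abs_mul, abs_of_nonneg (hg q), mul_comm]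
    exact mul_le_mul_of_nonneg_right h1 (hg q)
  simpa using h

lemma IsForcedCurve.continuousOn_incl {Φ : CircleC1 × CircleC1 → CircleC1} {I : Set ℝ}
    (h : IsForcedCurve Φ I X V) (hI : I ⊆ Ici 0) :
    ContinuousOn (fun t => incl (X t)) I ∧ ContinuousOn (fun t => incl (V t)) I :=
  ⟨fun t ht => (hasDerivWithinAt_incl (h.velocity t ht)).continuousWithinAt.mono hI,
    fun t ht => (hasDerivWithinAt_incl (h.acceleration t ht)).continuousWithinAt.mono hI⟩

/-! ### The case `λ = 2`. -/

section ForceTwo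

/-- The deviation of the velocity from its mean for `λ = 2`. -/
def deviation₂ (z : CircleC1 × CircleC1) : CircleC1 :=
  (2 : ℝ) • (primitive (incl z.1 * incl z.2) -
    avg (incl z.1 * incl z.1 * incl (primitive (incl z.1 * incl z.2))) • one)

/-- The central force for `λ = 2`. -/
def force₂ (σ : ℝ) (z : CircleC1 × CircleC1) : CircleC1 :=
  σ • deviation₂ z - avg (incl z.2 * incl z.2) • one

lemma contDiff_force₂ : ContDiff ℝ ∞ (force₂ σ) := by
  have h1 : ContDiff ℝ ∞ fun z : CircleC1 × CircleC1 => incl z.1 := contDiff_incl.comp contDiff_fst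
  have h2 : ContDiff ℝ ∞ fun z : CircleC1 × CircleC1 => incl z.2 := contDiff_incl.comp contDiff_snd
  have h3 : ContDiff ℝ ∞ fun z : CircleC1 × CircleC1 => primitive (incl z.1 * incl z.2) :=
    primitive.contDiff.comp (h1.mul h2)
  have h4 : ContDiff ℝ ∞ fun z : CircleC1 × CircleC1 =>
      avg (incl z.1 * incl z.1 * incl (primitive (incl z.1 * incl z.2))) :=
    avg.contDiff.comp ((h1.mul h1).mul (contDiff_incl.comp h3))
  have h5 : ContDiff ℝ ∞ fun z : CircleC1 × CircleC1 => avg (incl z.2 * incl z.2) :=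
    avg.contDiff.comp (h2.mul h2)
  exact (((h3.sub (h4.smul contDiff_const)).const_smul (2 : ℝ)).const_smul σ).sub
    (h5.smul contDiff_const)

lemma incl_deviation₂ (x v : CircleC1) : incl (deviation₂ (x, v)) =
    (2 : ℝ) • (incl (primitive (incl x * incl v)) -
      avg (incl x * incl x * incl (primitive (incl x * incl v))) • 1) := by
  simp [deviation₂]

lemma incl_force₂ (x v : CircleC1) : incl (force₂ σ (x, v)) =
    σ • incl (deviation₂ (x, v)) - avg (incl v * incl v) • 1 := by
  simp [force₂]

/-- The constraint `∫ x² = 1` is preserved. -/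
lemma IsForcedCurve.constraint₂ (h : IsForcedCurve (force₂ σ) (Ico 0 T) X V) (hX0 : X 0 = one)
    (hV0 : avg (incl (V 0)) = 0) : ∀ t ∈ Ico 0 T,
      avg (incl (X t) * incl (X t)) = 1 ∧ avg (incl (X t) * incl (V t)) = 0 := by
  set k : ℝ → ℝ := fun t =>
    avg (incl (X t) * incl (X t) * incl (primitive (incl (X t) * incl (V t)))) with hk
  set e : ℝ → ℝ := fun t => avg (incl (V t) * incl (V t)) with he
  set m : ℝ → ℝ := fun t => avg (incl (X t) * incl (X t)) with hm
  set p : ℝ → ℝ := fun t => avg (incl (X t) * incl (V t)) with hp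
  obtain ⟨hXc, hVc⟩ := h.continuousOn_incl Ico_subset_Ici_self
  have hkc : ContinuousOn k (Ico 0 T) := avg.continuous.comp_continuousOn
    ((hXc.mul hXc).mul (incl.continuous.comp_continuousOn
      (primitive.continuous.comp_continuousOn (hXc.mul hVc))))
  have hec : ContinuousOn e (Ico 0 T) := avg.continuous.comp_continuousOn (hVc.mul hVc)
  have hm' : ∀ t ∈ Ico 0 T, HasDerivWithinAt m (2 * p t) (Ici 0) t := fun t ht => by
    have hx := hasDerivWithinAt_incl (h.velocity t ht)
    refine (hasDerivWithinAt_clm avg (hx.mul hx)).congr_deriv ?_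
    rw [map_add, mul_comm (incl (V t))]
    ring
  -- The mean of `F x²` is `2σk(1 - m) - em`. Adding `∫ x_t² = e` leaves the factor `m - 1`, so `(m
  -- - 1, p)` solves a linear homogeneous system.
  have hp' : ∀ t ∈ Ico 0 T,
      HasDerivWithinAt p (-(m t - 1) * (e t + 2 * σ * k t)) (Ici 0) t := fun t ht => by
    have hx := hasDerivWithinAt_incl (h.velocity t ht)
    have hv := hasDerivWithinAt_incl (h.acceleration t ht)
    refine (hasDerivWithinAt_clm avg (hx.mul hv)).congr_deriv ?_
    have e1 : incl (V t) * incl (V t) + incl (X t) * incl (mulC1 (force₂ σ (X t, V t)) (X t)) =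
        incl (V t) * incl (V t) +
        ((2 * σ) • (incl (X t) * incl (X t) * incl (primitive (incl (X t) * incl (V t)))) -
          (2 * σ * k t + e t) • (incl (X t) * incl (X t))) := by
      rw [incl_mulC1, incl_force₂, incl_deviation₂]
      ext q
      simp [hk, he]
      ring
    rw [e1, map_add, map_sub, map_smul, map_smul, smul_eq_mul, smul_eq_mul]
    simp only [hk, he, hm]
    ring
  have hz := eq_zero_of_norm_deriv_le (T := T) (W := fun t => (m t - 1, p t))
    (W' := fun t => (2 * p t, -(m t - 1) * (e t + 2 * σ * k t)))
    (c := fun t => 2 + |e t + 2 * σ * k t|)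
    (fun t ht => ((hm' t ht).sub_const 1).prodMk (hp' t ht))
    (continuousOn_const.add (hec.add (continuousOn_const.mul hkc)).abs)
    (fun t _ => by
      have h1 : |m t - 1| ≤ ‖(m t - 1, p t)‖ := norm_fst_le (m t - 1, p t)
      have h2 : |p t| ≤ ‖(m t - 1, p t)‖ := norm_snd_le (m t - 1, p t)
      have h3 := abs_nonneg (e t + 2 * σ * k t)
      have h4 := norm_nonneg (m t - 1, p t)
      refine max_le ?_ ?_
      · rw [Real.norm_eq_abs, abs_mul, abs_two]
        nlinarith
      · rw [Real.norm_eq_abs, abs_mul, abs_neg]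
        nlinarith)
    (by simp [hm, hp, hX0, hV0])
  intro t ht
  have h1 := hz t ht
  simp only [Prod.mk_eq_zero] at h1
  exact ⟨by linarith [h1.1], h1.2⟩

/-- The energy is conserved. -/
lemma IsForcedCurve.energy₂ (h : IsForcedCurve (force₂ σ) (Ico 0 T) X V) (hX0 : X 0 = one)
    (hV0 : avg (incl (V 0)) = 0) : ∀ t ∈ Ico 0 T,
      avg (incl (V t) * incl (V t)) = avg (incl (V 0) * incl (V 0)) := by
  refine eq_of_deriv_eq_zero (W := fun t => avg (incl (V t) * incl (V t))) fun t ht => ?_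
  obtain ⟨-, hp⟩ := h.constraint₂ hX0 hV0 t ht
  have hv := hasDerivWithinAt_incl (h.acceleration t ht)
  refine (hasDerivWithinAt_clm avg (hv.mul hv)).congr_deriv ?_
  -- On the constraint `G_θ = 2 x x_t`, so `2 ∫ F x x_t` is `σ ∫ G G_θ` minus a multiple of `∫ x
  -- x_t`; both vanish.
  have hd : diff (deviation₂ (X t, V t)) = (2 : ℝ) • (incl (X t) * incl (V t)) := by
    simp [deviation₂, diff_primitive, hp]
  have e1 : incl (mulC1 (force₂ σ (X t, V t)) (X t)) * incl (V t) +
      incl (V t) * incl (mulC1 (force₂ σ (X t, V t)) (X t)) =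
      σ • (incl (deviation₂ (X t, V t)) * diff (deviation₂ (X t, V t))) -
        (2 * avg (incl (V t) * incl (V t))) • (incl (X t) * incl (V t)) := by
    rw [incl_mulC1, incl_force₂, hd]
    ext q
    simp
    ring
  rw [e1, map_sub, map_smul, map_smul, avg_incl_mul_diff, hp]
  simp

/-- For `λ = 2` the force stays bounded on bounded time intervals. -/
lemma IsForcedCurve.exists_bound_force₂ (h : IsForcedCurve (force₂ σ) (Ico 0 T) X V)
    (hX0 : X 0 = one) (hV0 : avg (incl (V 0)) = 0) :
    ∃ C, ∀ t ∈ Ico 0 T, ‖force₂ σ (X t, V t)‖ ≤ C := by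
  set e := avg (incl (V 0) * incl (V 0)) with he
  have hsup : ∀ t ∈ Ico 0 T, ‖incl (force₂ σ (X t, V t))‖ ≤ |σ| * (4 * (1 + e)) + |e| := by
    intro t ht
    obtain ⟨hm, -⟩ := h.constraint₂ hX0 hV0 t ht
    have hE := h.energy₂ hX0 hV0 t ht
    set A := incl (primitive (incl (X t) * incl (V t))) with hA
    -- `|x x_t| ≤ (x² + x_t²)/2`, whose mean is `(1 + e)/2`.
    have h1 : ‖A‖ ≤ 1 + e := by
      have := norm_incl_primitive_le (f := incl (X t) * incl (V t))
        (g := (2⁻¹ : ℝ) • (incl (X t) * incl (X t) + incl (V t) * incl (V t))) fun q => by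
          simp only [ContinuousMap.mul_apply, ContinuousMap.smul_apply, ContinuousMap.add_apply,
            smul_eq_mul]
          rw [abs_le]
          constructor <;> nlinarith [sq_nonneg (incl (X t) q - incl (V t) q),
            sq_nonneg (incl (X t) q + incl (V t) q)]
      rw [map_smul, map_add, hm, hE, smul_eq_mul] at this
      linarith
    have h2 : |avg (incl (X t) * incl (X t) * A)| ≤ ‖A‖ := by
      simpa [hm] using abs_avg_mul_le (f := A) (g := incl (X t) * incl (X t))
        fun q => mul_self_nonneg _
    have h3 : ‖incl (deviation₂ (X t, V t))‖ ≤ 4 * (1 + e) := by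
      rw [incl_deviation₂, norm_smul]
      have := norm_sub_le A (avg (incl (X t) * incl (X t) * A) • 1)
      rw [norm_smul, norm_one, mul_one, Real.norm_eq_abs] at this
      rw [Real.norm_eq_abs, abs_two]
      linarith
    rw [incl_force₂, hE]
    refine (norm_sub_le _ _).trans ?_
    rw [norm_smul, norm_smul, norm_one, mul_one, Real.norm_eq_abs, Real.norm_eq_abs]
    gcongr
  -- The uniform bound on `F` bounds `x` and `x_t` by Gronwall, and hence `F_θ = 2σ x x_t`.
  obtain ⟨B, hB⟩ := h.exists_bound hsup
  refine ⟨max (|σ| * (4 * (1 + e)) + |e|) (|σ| * (2 * (B * B))), fun t ht => ?_⟩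
  obtain ⟨-, hp⟩ := h.constraint₂ hX0 hV0 t ht
  have hd : diff (force₂ σ (X t, V t)) = σ • (2 : ℝ) • (incl (X t) * incl (V t)) := by
    simp [force₂, deviation₂, diff_primitive, hp]
  refine max_le_max (hsup t ht) ?_
  change ‖diff (force₂ σ (X t, V t))‖ ≤ _
  obtain ⟨h1, h2⟩ := hB t ht
  have hB0 : 0 ≤ B := (norm_nonneg _).trans h1
  rw [hd, norm_smul, norm_smul, Real.norm_eq_abs, Real.norm_eq_abs, abs_two]
  gcongr
  exact (norm_mul_le _ _).trans (by gcongr)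

end ForceTwo

/-! ### The case `λ = 3`. -/

section ForceThree

/-- The deviation of the velocity from its mean for `λ = 3`. -/
def deviation₃ (z : CircleC1 × CircleC1) : CircleC1 :=
  primitive (incl z.2) - avg (incl z.1 * incl (primitive (incl z.2))) • one

/-- The central force for `λ = 3`. -/
def force₃ (σ : ℝ) (z : CircleC1 × CircleC1) : CircleC1 := (3 * σ) • deviation₃ z

lemma contDiff_force₃ : ContDiff ℝ ∞ (force₃ σ) := by
  have h1 : ContDiff ℝ ∞ fun z : CircleC1 × CircleC1 => incl z.1 := contDiff_incl.comp contDiff_fst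
  have h2 : ContDiff ℝ ∞ fun z : CircleC1 × CircleC1 => incl z.2 := contDiff_incl.comp contDiff_snd
  have h3 : ContDiff ℝ ∞ fun z : CircleC1 × CircleC1 => primitive (incl z.2) :=
    primitive.contDiff.comp h2
  have h4 : ContDiff ℝ ∞ fun z : CircleC1 × CircleC1 =>
      avg (incl z.1 * incl (primitive (incl z.2))) :=
    avg.contDiff.comp (h1.mul (contDiff_incl.comp h3))
  exact (h3.sub (h4.smul contDiff_const)).const_smul (3 * σ)

lemma incl_deviation₃ (x v : CircleC1) : incl (deviation₃ (x, v)) =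
    incl (primitive (incl v)) - avg (incl x * incl (primitive (incl v))) • 1 := by
  simp [deviation₃]

lemma incl_force₃ (x v : CircleC1) :
    incl (force₃ σ (x, v)) = (3 * σ) • incl (deviation₃ (x, v)) := by
  simp [force₃]

lemma diff_deviation₃ {x v : CircleC1} (hv : avg (incl v) = 0) :
    diff (deviation₃ (x, v)) = incl v := by
  simp [deviation₃, diff_primitive, hv]

lemma avg_deviation₃_mul (x v : CircleC1) (hx : avg (incl x) = 1) :
    avg (incl (deviation₃ (x, v)) * incl x) = 0 := by
  rw [incl_deviation₃, sub_mul, map_sub, smul_mul_assoc, one_mul, map_smul, hx, mul_comm]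
  simp

/-- The constraint `∫ x = 1` is preserved. -/
lemma IsForcedCurve.constraint₃ (h : IsForcedCurve (force₃ σ) (Ico 0 T) X V) (hX0 : X 0 = one)
    (hV0 : avg (incl (V 0)) = 0) : ∀ t ∈ Ico 0 T,
      avg (incl (X t)) = 1 ∧ avg (incl (V t)) = 0 := by
  set k : ℝ → ℝ := fun t => avg (incl (X t) * incl (primitive (incl (V t)))) with hk
  set m : ℝ → ℝ := fun t => avg (incl (X t)) with hm
  set p : ℝ → ℝ := fun t => avg (incl (V t)) with hp
  obtain ⟨hXc, hVc⟩ := h.continuousOn_incl Ico_subset_Ici_self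
  have hkc : ContinuousOn k (Ico 0 T) := avg.continuous.comp_continuousOn
    (hXc.mul (incl.continuous.comp_continuousOn (primitive.continuous.comp_continuousOn hVc)))
  have hm' : ∀ t ∈ Ico 0 T, HasDerivWithinAt m (p t) (Ici 0) t := fun t ht =>
    hasDerivWithinAt_clm avg (hasDerivWithinAt_incl (h.velocity t ht))
  have hp' : ∀ t ∈ Ico 0 T,
      HasDerivWithinAt p (-(m t - 1) * (3 * σ * k t)) (Ici 0) t := fun t ht => by
    refine (hasDerivWithinAt_clm avg (hasDerivWithinAt_incl (h.acceleration t ht))).congr_deriv ?_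
    have e1 : incl (mulC1 (force₃ σ (X t, V t)) (X t)) =
        (3 * σ) • (incl (X t) * incl (primitive (incl (V t))) - k t • incl (X t)) := by
      rw [incl_mulC1, incl_force₃, incl_deviation₃]
      ext q
      simp [hk, -mul_eq_mul_left_iff]
      ring
    rw [e1, map_smul, map_sub, map_smul, smul_eq_mul, smul_eq_mul]
    simp only [hk, hm]
    ring
  have hz := eq_zero_of_norm_deriv_le (T := T) (W := fun t => (m t - 1, p t))
    (W' := fun t => (p t, -(m t - 1) * (3 * σ * k t)))
    (c := fun t => 1 + |3 * σ * k t|)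
    (fun t ht => ((hm' t ht).sub_const 1).prodMk (hp' t ht))
    (continuousOn_const.add (continuousOn_const.mul hkc).abs)
    (fun t _ => by
      have h1 : |m t - 1| ≤ ‖(m t - 1, p t)‖ := norm_fst_le (m t - 1, p t)
      have h2 : |p t| ≤ ‖(m t - 1, p t)‖ := norm_snd_le (m t - 1, p t)
      have h3 := abs_nonneg (3 * σ * k t)
      have h4 := norm_nonneg (m t - 1, p t)
      refine max_le ?_ ?_
      · rw [Real.norm_eq_abs]
        nlinarith
      · rw [Real.norm_eq_abs, abs_mul, abs_neg]
        nlinarith)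
    (by simp [hm, hp, hX0, hV0])
  intro t ht
  have h1 := hz t ht
  simp only [Prod.mk_eq_zero] at h1
  exact ⟨by linarith [h1.1], h1.2⟩

/-- With `P` the primitive, `G = P(x_t) - ∫ x P(x_t)` and `x_tt = 3σ G x`. The term `∫ x_t P(x_t)`
is the integral of a derivative, so `G_t` involves only the primitive of `G x`. -/
lemma IsForcedCurve.hasDerivWithinAt_deviation₃ (h : IsForcedCurve (force₃ σ) (Ico 0 T) X V)
    (hX0 : X 0 = one) (hV0 : avg (incl (V 0)) = 0) {t : ℝ} (ht : t ∈ Ico 0 T) :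
    HasDerivWithinAt (fun t => incl (deviation₃ (X t, V t)))
      ((3 * σ) • (incl (primitive (incl (deviation₃ (X t, V t)) * incl (X t))) -
        avg (incl (X t) * incl (primitive (incl (deviation₃ (X t, V t)) * incl (X t)))) • 1))
      (Ici 0) t := by
  obtain ⟨-, hp⟩ := h.constraint₃ hX0 hV0 t ht
  set D := incl (deviation₃ (X t, V t)) with hD
  have hx := hasDerivWithinAt_incl (h.velocity t ht)
  have hv := hasDerivWithinAt_incl (h.acceleration t ht)
  have ha := hasDerivWithinAt_incl (hasDerivWithinAt_clm primitive hv)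
  have hk := (hasDerivWithinAt_clm avg (hx.mul ha)).smul_const (1 : C(UnitAddCircle, ℝ))
  have hfun : (fun t => incl (deviation₃ (X t, V t))) = fun t =>
      incl (primitive (incl (V t))) - avg (incl (X t) * incl (primitive (incl (V t)))) • 1 :=
    funext fun t => incl_deviation₃ _ _
  have h0 : avg (incl (V t) * incl (primitive (incl (V t)))) = 0 := by
    have := avg_incl_mul_diff (primitive (incl (V t)))
    rwa [diff_primitive, hp, zero_smul, sub_zero, mul_comm] at this
  have hF : incl (mulC1 (force₃ σ (X t, V t)) (X t)) = (3 * σ) • (D * incl (X t)) := by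
    rw [incl_mulC1, incl_force₃, smul_mul_assoc]
  rw [hfun]
  refine (ha.sub hk).congr_deriv ?_
  rw [hF, map_add, h0, zero_add, map_smul, map_smul, mul_smul_comm, map_smul, smul_sub, smul_smul,
    smul_eq_mul]

/-- For `λ = 3` the integral `∫ G² x` is conserved. -/
lemma IsForcedCurve.avg_deviation₃_sq (h : IsForcedCurve (force₃ σ) (Ico 0 T) X V)
    (hX0 : X 0 = one) (hV0 : avg (incl (V 0)) = 0) : ∀ t ∈ Ico 0 T,
    avg (incl (deviation₃ (X t, V t)) * incl (deviation₃ (X t, V t)) * incl (X t)) =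
      avg (incl (deviation₃ (X 0, V 0)) * incl (deviation₃ (X 0, V 0)) * incl (X 0)) := by
  refine eq_of_deriv_eq_zero (W := fun t =>
    avg (incl (deviation₃ (X t, V t)) * incl (deviation₃ (X t, V t)) * incl (X t))) fun t ht => ?_
  obtain ⟨hm, hp⟩ := h.constraint₃ hX0 hV0 t ht
  have hd := h.hasDerivWithinAt_deviation₃ hX0 hV0 ht
  have hx := hasDerivWithinAt_incl (h.velocity t ht)
  refine (hasDerivWithinAt_clm avg ((hd.mul hd).mul hx)).congr_deriv ?_
  -- Three integrals vanish: `∫ G x`, `∫ G² x_t = ∫ G² G_θ`, and `∫ H G x = ∫ H H_θ` for the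
  -- primitive `H` of `G x`.
  have h1 := avg_deviation₃_mul (X t) (V t) hm
  have h2 := avg_incl_mul_incl_mul_diff (deviation₃ (X t, V t))
  rw [diff_deviation₃ hp] at h2
  set D := incl (deviation₃ (X t, V t)) with hD
  have h3 := avg_incl_mul_diff (primitive (D * incl (X t)))
  rw [diff_primitive, h1, zero_smul, sub_zero] at h3
  set H := incl (primitive (D * incl (X t))) with hH
  have e1 : ((3 * σ) • (H - avg (incl (X t) * H) • 1) * D +
      D * (3 * σ) • (H - avg (incl (X t) * H) • 1)) * incl (X t) + D * D * incl (V t) =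
      (6 * σ) • (H * (D * incl (X t))) - (6 * σ * avg (incl (X t) * H)) • (D * incl (X t)) +
        D * D * incl (V t) := by
    ext q
    simp
    ring
  rw [Pi.mul_apply, ← hD, e1, map_add, map_sub, map_smul, map_smul, h1, h2, h3]
  simp

/-- For `λ = 3` the force stays bounded on bounded time intervals as long as `x ≥ 0`. -/
lemma IsForcedCurve.exists_bound_force₃ (h : IsForcedCurve (force₃ σ) (Ico 0 T) X V)
    (hX0 : X 0 = one) (hV0 : avg (incl (V 0)) = 0)
    (hpos : ∀ t ∈ Ico 0 T, ∀ q, 0 ≤ incl (X t) q) :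
    ∃ C, ∀ t ∈ Ico 0 T, ‖force₃ σ (X t, V t)‖ ≤ C := by
  set Q := avg (incl (deviation₃ (X 0, V 0)) * incl (deviation₃ (X 0, V 0)) * incl (X 0)) with hQ
  set C := |3 * σ| * (2 * (Q + 1)) with hC
  have hderiv : ∀ t ∈ Ico 0 T,
      ‖(3 * σ) • (incl (primitive (incl (deviation₃ (X t, V t)) * incl (X t))) -
        avg (incl (X t) * incl (primitive (incl (deviation₃ (X t, V t)) * incl (X t)))) •
          (1 : C(UnitAddCircle, ℝ)))‖ ≤ C := by
    intro t ht
    obtain ⟨hm, -⟩ := h.constraint₃ hX0 hV0 t ht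
    have hq := h.avg_deviation₃_sq hX0 hV0 t ht
    set D := incl (deviation₃ (X t, V t)) with hD
    -- `|G x| ≤ (G² x + x)/2`, which needs `x ≥ 0`; the mean of the right side is `(Q + 1)/2`.
    have h1 : ‖incl (primitive (D * incl (X t)))‖ ≤ Q + 1 := by
      have := norm_incl_primitive_le (f := D * incl (X t))
        (g := (2⁻¹ : ℝ) • (D * D * incl (X t) + incl (X t))) fun q => by
          simp only [ContinuousMap.mul_apply, ContinuousMap.smul_apply, ContinuousMap.add_apply,
            smul_eq_mul]
          have hx := hpos t ht q
          rw [abs_le]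
          constructor <;> nlinarith [mul_nonneg hx (sq_nonneg (D q - 1)),
            mul_nonneg hx (sq_nonneg (D q + 1))]
      rw [map_smul, map_add, hm, hq, smul_eq_mul] at this
      linarith
    have h2 := abs_avg_mul_le (f := incl (primitive (D * incl (X t)))) (hpos t ht)
    rw [hm, mul_one] at h2
    rw [norm_smul, Real.norm_eq_abs, hC]
    gcongr
    refine (norm_sub_le _ _).trans ?_
    rw [norm_smul, norm_one, mul_one, Real.norm_eq_abs]
    linarith
  have hsup : ∀ t ∈ Ico 0 T, ‖incl (force₃ σ (X t, V t))‖ ≤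
      |3 * σ| * (‖incl (deviation₃ (X 0, V 0))‖ + C * T) := by
    intro t ht
    have hT : 0 < T := ht.1.trans_lt ht.2
    have hC0 : 0 ≤ C := (norm_nonneg _).trans (hderiv t ht)
    -- As `‖G_t‖ ≤ C`, the deviation grows at most linearly in time.
    have h1 := (convex_Ico 0 T).norm_image_sub_le_of_norm_hasDerivWithin_le
      (fun s hs => (h.hasDerivWithinAt_deviation₃ hX0 hV0 hs).mono Ico_subset_Ici_self) hderiv
      ⟨le_rfl, hT⟩ ht
    have h2 : C * ‖t - 0‖ ≤ C * T := by
      rw [sub_zero, Real.norm_eq_abs, abs_of_nonneg ht.1]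
      gcongr
      exact ht.2.le
    rw [incl_force₃, norm_smul, Real.norm_eq_abs]
    gcongr
    have h3 := norm_sub_norm_le (incl (deviation₃ (X t, V t))) (incl (deviation₃ (X 0, V 0)))
    linarith
  obtain ⟨B, hB⟩ := h.exists_bound hsup
  refine ⟨max (|3 * σ| * (‖incl (deviation₃ (X 0, V 0))‖ + C * T)) (|3 * σ| * B), fun t ht => ?_⟩
  obtain ⟨-, hp⟩ := h.constraint₃ hX0 hV0 t ht
  refine max_le_max (hsup t ht) ?_
  change ‖diff (force₃ σ (X t, V t))‖ ≤ _
  rw [force₃, map_smul, diff_deviation₃ hp, norm_smul, Real.norm_eq_abs]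
  gcongr
  exact (hB t ht).2

end ForceThree

end MuLambda

end

/-! ### From the abstract system back to equations (1) and (2). -/

noncomputable section

namespace MuLambda

open Set Filter Topology

variable {σ : ℝ}

lemma gam_two : gam 2 = 2 := by norm_num [gam]

lemma gam_three : gam 3 = 1 := by norm_num [gam]

lemma incl_primitive_of_avg_eq_zero {f : C(UnitAddCircle, ℝ)} (hf : avg f = 0) (θ : ℝ) :
    incl (primitive f) (θ : UnitAddCircle) = ∫ s in (0 : ℝ)..θ, f (s : UnitAddCircle) := by
  rw [incl_primitive, hf, mul_zero, sub_zero]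

/-- The smooth force uses mean-free primitives so as to be periodic on the whole space; when `∫ x v
= 0` nothing is subtracted. -/
lemma force_two_eq {x v : CircleC1} (hp : avg (incl x * incl v) = 0) (θ : ℝ) :
    force 2 σ (toFn x) (toFn v) θ = incl (force₂ σ (x, v)) (θ : UnitAddCircle) := by
  have h1 : ∀ r : ℝ, ∫ s in (0 : ℝ)..r, incl x (s : UnitAddCircle) * incl v (s : UnitAddCircle) =
      incl (primitive (incl x * incl v)) (r : UnitAddCircle) := fun r =>
    (incl_primitive_of_avg_eq_zero hp r).symm
  have h2 : avg (incl v * incl v) = ∫ s in (0 : ℝ)..1, incl v (s : UnitAddCircle) ^ 2 := by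
    simp only [avg_apply, ContinuousMap.mul_apply, pow_two]
  have h3 : avg (incl x * incl x * incl (primitive (incl x * incl v))) =
      ∫ s in (0 : ℝ)..1, incl x (s : UnitAddCircle) ^ 2 *
        incl (primitive (incl x * incl v)) (s : UnitAddCircle) := by
    simp only [avg_apply, ContinuousMap.mul_apply, pow_two]
  have e1 : (2 : ℝ) - 1 = 1 := by norm_num
  simp only [force, energy, velocityDeviation, gam_two, toFn_eq, sub_self, Real.rpow_zero, one_mul,
    e1, Real.rpow_one, Real.rpow_two, h1, incl_force₂, incl_deviation₂, h2, h3,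
    ContinuousMap.sub_apply, ContinuousMap.smul_apply, ContinuousMap.one_apply, smul_eq_mul]
  ring

/-- As for `λ = 2`; the energy, whose integrand contains `x⁻¹`, is multiplied by zero. -/
lemma force_three_eq {x v : CircleC1} (hp : avg (incl v) = 0) (θ : ℝ) :
    force 3 σ (toFn x) (toFn v) θ = incl (force₃ σ (x, v)) (θ : UnitAddCircle) := by
  have h1 : ∀ r : ℝ, ∫ s in (0 : ℝ)..r, incl v (s : UnitAddCircle) =
      incl (primitive (incl v)) (r : UnitAddCircle) := fun r =>
    (incl_primitive_of_avg_eq_zero hp r).symm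
  have h3 : avg (incl x * incl (primitive (incl v))) =
      ∫ s in (0 : ℝ)..1, incl x (s : UnitAddCircle) *
        incl (primitive (incl v)) (s : UnitAddCircle) := by
    simp only [avg_apply, ContinuousMap.mul_apply]
  simp only [force, energy, velocityDeviation, gam_three, toFn_eq, sub_self, Real.rpow_zero,
    one_mul, Real.rpow_one, h1, incl_force₃, incl_deviation₃, h3,
    ContinuousMap.sub_apply, ContinuousMap.smul_apply, ContinuousMap.one_apply, smul_eq_mul]
  ring

section Translation

variable {Φ : CircleC1 × CircleC1 → CircleC1} {I : Set ℝ} {X V : ℝ → CircleC1}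
  {Y Z : ℝ → C(UnitAddCircle, ℝ)} {lam : ℝ} {u₀ : ℝ → ℝ}

lemma IsForcedCurve.derivWithin_eq (h : IsForcedCurve Φ I X V) (hI : UniqueDiffOn ℝ I)
    (hI0 : I ⊆ Ici 0) {t : ℝ} (ht : t ∈ I) :
    derivWithin (F := C1Circle) X I t = V t :=
  ((h.velocity t ht).mono hI0).derivWithin (hI t ht)

lemma IsForcedCurve.forceAlong_eq (h : IsForcedCurve Φ I X V) (hI : UniqueDiffOn ℝ I)
    (hI0 : I ⊆ Ici 0)
    (hforce : ∀ t ∈ I, ∀ θ : ℝ, force lam σ (toFn (X t)) (toFn (V t)) θ =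
      incl (Φ (X t, V t)) (θ : UnitAddCircle)) {t : ℝ} (ht : t ∈ I) (θ : ℝ) :
    forceAlong lam σ I X t θ = incl (Φ (X t, V t)) (θ : UnitAddCircle) := by
  change force lam σ (toFn (X t)) (toFn (derivWithin (F := C1Circle) X I t)) θ = _
  rw [h.derivWithin_eq hI hI0 ht, hforce t ht]

lemma IsForcedCurve.isXSolution (hΦ : ContDiff ℝ ∞ Φ) (h : IsForcedCurve Φ I X V)
    (hI : UniqueDiffOn ℝ I) (hI0 : I ⊆ Ici 0) (h0 : 0 ∈ I)
    (hY : IsLinearForcedCurve (fun t => Φ (X t, V t)) I Y Z)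
    (hforce : ∀ t ∈ I, ∀ θ : ℝ, force lam (mean u₀) (toFn (X t)) (toFn (V t)) θ =
      incl (Φ (X t, V t)) (θ : UnitAddCircle))
    (hconstr : ∀ t ∈ I, ∫ θ in (0 : ℝ)..1, toFn (X t) θ ^ gam lam = 1)
    (hX0 : X 0 = one) (hV0 : ∀ θ : ℝ, incl (V 0) (θ : UnitAddCircle) = deriv u₀ θ / gam lam) :
    IsXSolution lam u₀ I X where
  smooth := (h.contDiffOn hΦ hI hI0 hY).1
  constraint := hconstr
  equation := by
    intro t ht θ
    have h1 : derivWithin (F := C1Circle) (derivWithin (F := C1Circle) X I) I t =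
        mulC1 (Φ (X t, V t)) (X t) := by
      have hd : HasDerivWithinAt (F := C1Circle) V (mulC1 (Φ (X t, V t)) (X t)) I t :=
        (h.acceleration t ht).mono hI0
      exact (hd.congr_of_mem (fun s hs => h.derivWithin_eq hI hI0 hs) ht).derivWithin (hI t ht)
    rw [h.forceAlong_eq hI hI0 hforce ht, h1, toFn_eq, incl_mulC1]
    rfl
  init := fun θ => by rw [hX0, toFn_eq]; rfl
  init_deriv := fun θ => by rw [h.derivWithin_eq hI hI0 h0, toFn_eq, hV0]

lemma IsForcedCurve.isYSolution (hΦ : ContDiff ℝ ∞ Φ) (h : IsForcedCurve Φ I X V)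
    (hI : UniqueDiffOn ℝ I) (hI0 : I ⊆ Ici 0) (h0 : 0 ∈ I)
    (hY : IsLinearForcedCurve (fun t => Φ (X t, V t)) I Y Z)
    (hforce : ∀ t ∈ I, ∀ θ : ℝ, force lam (mean u₀) (toFn (X t)) (toFn (V t)) θ =
      incl (Φ (X t, V t)) (θ : UnitAddCircle))
    (hY0 : Y 0 = 0)
    (hZ0 : ∀ θ : ℝ, Z 0 (θ : UnitAddCircle) = mean u₀ - iteratedDeriv 2 u₀ θ) :
    IsYSolution lam u₀ I X Y where
  smooth := (h.contDiffOn hΦ hI hI0 hY).2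
  equation := by
    intro t ht θ
    have h1 : derivWithin (derivWithin Y I) I t = incl (Φ (X t, V t)) * Y t :=
      (((hY.acceleration t ht).mono hI0).congr_of_mem
        (fun s hs => ((hY.velocity s hs).mono hI0).derivWithin (hI s hs)) ht).derivWithin (hI t ht)
    rw [h.forceAlong_eq hI hI0 hforce ht, h1, ContinuousMap.mul_apply]
  init := fun θ => by rw [hY0, ContinuousMap.zero_apply]
  init_deriv := fun θ => by rw [((hY.velocity 0 h0).mono hI0).derivWithin (hI 0 h0), hZ0]

end Translation

/-! ### The first zero of `x`. -/

section FirstZero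

/-- A continuous curve of functions on the circle that starts at `1` and fails to be positive at
some later time has a first time at which it vanishes somewhere. -/
lemma exists_first_zero {X : ℝ → C(UnitAddCircle, ℝ)} {s : ℝ} (hs : 0 ≤ s)
    (hX : ContinuousOn X (Icc 0 s)) (hX0 : X 0 = 1) {θ₀ : ℝ} (hθ₀ : X s (θ₀ : UnitAddCircle) ≤ 0) :
    ∃ τ ∈ Icc 0 s, IsLeast {t | t ∈ Icc 0 s ∧ ∃ θ : ℝ, X t (θ : UnitAddCircle) = 0} τ := by
  have hcont : ContinuousOn (fun p : ℝ × UnitAddCircle => X p.1 p.2) (Icc 0 s ×ˢ univ) := by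
    have h1 : ContinuousOn (fun p : ℝ × UnitAddCircle => (X p.1, p.2)) (Icc 0 s ×ˢ univ) :=
      (hX.comp continuousOn_fst fun p hp => hp.1).prodMk continuousOn_snd
    exact ContinuousEval.continuous_eval.comp_continuousOn h1
  have hcomp : IsCompact (Icc (0 : ℝ) s ×ˢ (univ : Set UnitAddCircle)) :=
    isCompact_Icc.prod isCompact_univ
  set S : Set ℝ := {t | t ∈ Icc 0 s ∧ ∃ θ : ℝ, X t (θ : UnitAddCircle) = 0} with hS
  -- The set of zero times is a projection of a compact set, so it has a least element once it is
  -- nonempty.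
  have hSeq : S = Prod.fst '' ((Icc (0 : ℝ) s ×ˢ (univ : Set UnitAddCircle)) ∩
      (fun p : ℝ × UnitAddCircle => X p.1 p.2) ⁻¹' {0}) := by
    ext t
    constructor
    · rintro ⟨ht, θ, hθ⟩
      exact ⟨(t, θ), ⟨⟨ht, mem_univ _⟩, hθ⟩, rfl⟩
    · rintro ⟨⟨t', q⟩, ⟨⟨ht, -⟩, hq⟩, rfl⟩
      obtain ⟨θ, -, rfl⟩ := exists_mem_Ico_coe_eq q
      exact ⟨ht, θ, hq⟩
  have hScomp : IsCompact S := by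
    rw [hSeq]
    exact (hcomp.of_isClosed_subset (hcont.preimage_isClosed_of_isClosed hcomp.isClosed
      isClosed_singleton) inter_subset_left).image continuous_fst
  have hne : S.Nonempty := by
    have hpt : ContinuousOn (fun t => X t (θ₀ : UnitAddCircle)) (Icc 0 s) :=
      (continuous_eval_const _).comp_continuousOn hX
    obtain ⟨t, ht, ht0⟩ := intermediate_value_Icc' hs hpt
      (show (0 : ℝ) ∈ Icc _ _ from ⟨hθ₀, by simp [hX0]⟩)
    exact ⟨t, ht, θ₀, ht0⟩
  obtain ⟨τ, hτ⟩ := hScomp.exists_isLeast hne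
  exact ⟨τ, hτ.1.1, hτ⟩

end FirstZero

/-! ### The initial data. -/

section InitialData

variable {u₀ : ℝ → ℝ}

lemma periodic_deriv {f : ℝ → ℝ} (hf : Function.Periodic f 1) : Function.Periodic (deriv f) 1 :=
  fun θ => by rw [← deriv_comp_add_const, funext hf]

/-- The mean of `u₀'` vanishes by periodicity, which starts the constraint off correctly; `u₀ ∈ C²`
puts `u₀'` in C¹(S¹). -/
lemma exists_initial_data (hper : Function.Periodic u₀ 1) (hu₀ : ContDiff ℝ 2 u₀) (c : ℝ) :
    ∃ (v : CircleC1) (w : C(UnitAddCircle, ℝ)), avg (incl v) = 0 ∧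
      (∀ θ : ℝ, incl v (θ : UnitAddCircle) = deriv u₀ θ / c) ∧
      ∀ θ : ℝ, w (θ : UnitAddCircle) = mean u₀ - iteratedDeriv 2 u₀ θ := by
  have h2 : iteratedDeriv 2 u₀ = deriv (deriv u₀) := by
    rw [iteratedDeriv_succ, iteratedDeriv_one]
  have hd1 : ∀ θ, HasDerivAt u₀ (deriv u₀ θ) θ := fun θ =>
    (hu₀.differentiable (by norm_num)).differentiableAt.hasDerivAt
  have hC1 : ContDiff ℝ 1 (deriv u₀) :=
    (contDiff_succ_iff_deriv (n := 1)).1 (by simpa [one_add_one_eq_two] using hu₀) |>.2.2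
  have hd2 : ∀ θ, HasDerivAt (deriv u₀) (deriv (deriv u₀) θ) θ := fun θ =>
    (hC1.differentiable (by norm_num)).differentiableAt.hasDerivAt
  have hc2 : Continuous (deriv (deriv u₀)) := hC1.continuous_deriv le_rfl
  set f₀ := ofPeriodic u₀ hper hu₀.continuous
  set f₁ := ofPeriodic (deriv u₀) (periodic_deriv hper) hC1.continuous
  set f₂ := ofPeriodic (deriv (deriv u₀)) (periodic_deriv (periodic_deriv hper)) hc2
  refine ⟨c⁻¹ • mkC1 f₁ f₂ fun θ => by simpa [f₁, f₂] using hd2 θ, mean u₀ • 1 - f₂, ?_, ?_, ?_⟩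
  · have := avg_diff (mkC1 f₀ f₁ fun θ => by simpa [f₀, f₁] using hd1 θ)
    rw [diff_mkC1] at this
    rw [map_smul, incl_mkC1, map_smul, this, smul_zero]
  · intro θ
    rw [map_smul, incl_mkC1, ContinuousMap.smul_apply, ofPeriodic_coe, smul_eq_mul]
    ring
  · intro θ
    simp [f₂, h2]

end InitialData

end MuLambda

end

/-! ### The theorem. -/

open MuLambda Set

theorem theorem5p2 (u₀ : ℝ → ℝ) (hper : Function.Periodic u₀ 1) (hu₀ : ContDiff ℝ 2 u₀) :
    (∃ (x : ℝ → MuLambda.C1Circle) (y : ℝ → C(UnitAddCircle, ℝ)),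
      MuLambda.IsXSolution 2 u₀ (Set.Ici 0) x ∧ MuLambda.IsYSolution 2 u₀ (Set.Ici 0) x y) ∧
    ((∃ (x : ℝ → MuLambda.C1Circle) (y : ℝ → C(UnitAddCircle, ℝ)),
        MuLambda.IsXSolution 3 u₀ (Set.Ici 0) x ∧ MuLambda.IsYSolution 3 u₀ (Set.Ici 0) x y ∧
        ∀ t ∈ Set.Ici (0 : ℝ), ∀ θ : ℝ, 0 < MuLambda.toFn (x t) θ) ∨
      (∃ (T ε : ℝ) (x : ℝ → MuLambda.C1Circle) (y : ℝ → C(UnitAddCircle, ℝ)),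
        0 < ε ∧
        IsLeast {t | t ∈ Set.Ico 0 (T + ε) ∧ ∃ θ : ℝ, MuLambda.toFn (x t) θ = 0} T ∧
        MuLambda.IsXSolution 3 u₀ (Set.Ico 0 (T + ε)) x ∧
        MuLambda.IsYSolution 3 u₀ (Set.Ico 0 (T + ε)) x y)) := by
  constructor
  · obtain ⟨v, w, hv0, hv, hw⟩ := exists_initial_data hper hu₀ (gam 2)
    obtain ⟨X, V, Y, Z, hX0, rfl, hY0, rfl, I, hI, hXV, hYZ⟩ :=
      exists_maximal_forcedCurve (contDiff_force₂ (σ := mean u₀)) one v 0 w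
    obtain rfl : I = Ici 0 := by
      refine hI.resolve_right ?_
      rintro ⟨T, -, rfl, hub⟩
      obtain ⟨C, hC⟩ := hXV.exists_bound_force₂ hX0 hv0
      obtain ⟨t, ht, hlt⟩ := hub C
      exact absurd (hC t ht) (not_le.2 hlt)
    have hc : ∀ t ∈ Ici (0 : ℝ), _ := fun t (ht : 0 ≤ t) =>
      (hXV.mono (J := Ico 0 (t + 1)) Ico_subset_Ici_self).constraint₂ hX0 hv0 t
        ⟨ht, by linarith⟩
    have hforce := fun t ht θ => force_two_eq (σ := mean u₀) (hc t ht).2 θ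
    refine ⟨X, Y, hXV.isXSolution contDiff_force₂ (uniqueDiffOn_Ici 0) subset_rfl self_mem_Ici hYZ
      hforce (fun t ht => ?_) hX0 hv, hXV.isYSolution contDiff_force₂ (uniqueDiffOn_Ici 0)
      subset_rfl self_mem_Ici hYZ hforce hY0 hw⟩
    refine Eq.trans ?_ (hc t ht).1
    rw [avg_apply]
    simp only [gam_two, Real.rpow_two, toFn_eq, ContinuousMap.mul_apply, pow_two]
  · obtain ⟨v, w, hv0, hv, hw⟩ := exists_initial_data hper hu₀ (gam 3)
    obtain ⟨X, V, Y, Z, hX0, rfl, hY0, rfl, I, hI, hXV, hYZ⟩ :=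
      exists_maximal_forcedCurve (contDiff_force₃ (σ := mean u₀)) one v 0 w
    have hI0 : I ⊆ Ici 0 := by
      rcases hI with rfl | ⟨T, -, rfl, -⟩
      · exact subset_rfl
      · exact Ico_subset_Ici_self
    -- The existence interval is open to the right; this supplies the room `ε` beyond the first
    -- zero.
    have hIco : ∀ t ∈ I, ∃ b > t, Ico 0 b ⊆ I := by
      rcases hI with rfl | ⟨T, -, rfl, -⟩
      · exact fun t _ => ⟨t + 1, by simp, Ico_subset_Ici_self⟩
      · exact fun t ht => ⟨T, ht.2, subset_rfl⟩
    have hc : ∀ t ∈ I, avg (incl (X t)) = 1 ∧ avg (incl (V t)) = 0 := fun t ht => by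
      obtain ⟨b, hb, hsub⟩ := hIco t ht
      exact (hXV.mono hsub).constraint₃ hX0 hv0 t ⟨hI0 ht, hb⟩
    have hforce := fun t ht θ => force_three_eq (σ := mean u₀) (x := X t) (hc t ht).2 θ
    have hconstr : ∀ t ∈ I, ∫ θ in (0 : ℝ)..1, toFn (X t) θ ^ gam 3 = 1 := fun t ht => by
      refine Eq.trans ?_ (hc t ht).1
      rw [avg_apply]
      simp only [gam_three, Real.rpow_one, toFn_eq]
    by_cases hpos : ∀ t ∈ I, ∀ θ : ℝ, 0 < toFn (X t) θ
    · left
      obtain rfl : I = Ici 0 := by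
        refine hI.resolve_right ?_
        rintro ⟨T, -, rfl, hub⟩
        obtain ⟨C, hC⟩ := hXV.exists_bound_force₃ hX0 hv0 fun t ht q => by
          obtain ⟨θ, -, rfl⟩ := exists_mem_Ico_coe_eq q
          exact (hpos t ht θ).le
        obtain ⟨t, ht, hlt⟩ := hub C
        exact absurd (hC t ht) (not_le.2 hlt)
      exact ⟨X, Y, hXV.isXSolution contDiff_force₃ (uniqueDiffOn_Ici 0) subset_rfl self_mem_Ici hYZ
        hforce hconstr hX0 hv, hXV.isYSolution contDiff_force₃ (uniqueDiffOn_Ici 0)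
        subset_rfl self_mem_Ici hYZ hforce hY0 hw, hpos⟩
    · right
      push Not at hpos
      obtain ⟨s, hs, θ₀, hθ₀⟩ := hpos
      obtain ⟨b, hb, hsub⟩ := hIco s hs
      have hXc : ContinuousOn (fun t => incl (X t)) (Icc 0 s) :=
        (hXV.continuousOn_incl hI0).1.mono ((Icc_subset_Ico_right hb).trans hsub)
      obtain ⟨τ, hτs, hτ⟩ := exists_first_zero (hI0 hs) hXc (by simp [hX0]) hθ₀
      have hb0 : 0 < b := (hτs.1.trans hτs.2).trans_lt hb
      have hu : UniqueDiffOn ℝ (Ico 0 b) := uniqueDiffOn_Ico 0 b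
      have h0 : (0 : ℝ) ∈ Ico 0 b := ⟨le_rfl, hb0⟩
      -- The interval ends at `b`, which exceeds `s ≥ τ`.
      refine ⟨τ, b - τ, X, Y, by linarith [hτs.2], ?_⟩
      rw [add_sub_cancel]
      refine ⟨⟨⟨⟨hτs.1, hτs.2.trans_lt hb⟩, hτ.1.2⟩, fun t ht => ?_⟩,
        (hXV.mono hsub).isXSolution contDiff_force₃ hu Ico_subset_Ici_self h0 (hYZ.mono hsub)
          (fun t ht => hforce t (hsub ht)) (fun t ht => hconstr t (hsub ht)) hX0 hv,
        (hXV.mono hsub).isYSolution contDiff_force₃ hu Ico_subset_Ici_self h0 (hYZ.mono hsub)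
          (fun t ht => hforce t (hsub ht)) hY0 hw⟩
      -- Minimality is known on `[0, s]` only; later zeros come after `s ≥ τ` anyway.
      rcases le_total t s with h | h
      · exact hτ.2 ⟨⟨ht.1.1, h⟩, ht.2⟩
      · exact hτs.2.trans h
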